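/- Let $X$ be a metric space with a distinguished base point $0\in X$, and let $\mathbb{K}$ be $\mathbb{R}$ or $\mathbb{C}$. Let $\mathrm{Lip}_0(X)$ be the space of all Lipschitz functions $f\colon X\to\mathbb{K}$ with $f(0)=0$, with the norm $$\mathrm{Lip}(f)=\sup\left\{\frac{|f(x)-f(y)|}{d(x,y)}\colon x,y\in X,\ x\neq y\right\}$$ (with $\sup\emptyset=0$) and closed unit ball $B$; norm bounded subsets of $\mathrm{Lip}_0(X)$ are those bounded for this norm. Let $\tau_0$ be the topology on $\mathrm{Lip}_0(X)$ of uniform convergence on the compact subsets of $X$. Let $\tau_\gamma$ be the mixed topology $\gamma[\mathrm{Lip},\tau_0]$, that is, the locally convex topology on $\mathrm{Lip}_0(X)$ for which the sets $$\gamma(U)=\bigcup_{n=1}^{\infty}\left(U_1\cap B+U_2\cap 2B+\cdots+U_n\cap 2^{n-1}B\right),$$ with $U=\{U_n\}$ running over the sequences of convex balanced $\tau_0$-neighbourhoods of zero, form a base of neighbourhoods of zero. Let $\mathcal{F}(X)$ be the norm closed linear hull in the dual Banach space $\mathrm{Lip}_0(X)'$ of the evaluation functionals $\delta_x\colon f\mapsto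 f(x)$, $x\in X$, with the dual norm. For a topological vector space $E$, let $E'$ be the space of continuous linear functionals on $E$, and let $E'_b$ and $E'_c$ denote $E'$ with the topology of uniform convergence on the bounded subsets of $E$, respectively on the convex balanced compact subsets of $E$. For $f\in\mathrm{Lip}_0(X)$ let $T_f\colon\mathcal{F}(X)\to\mathbb{K}$ be given by $T_f(\varphi)=\varphi(f)$. Then: (i) $\tau_\gamma$ is the largest (finest) topology on $\mathrm{Lip}_0(X)$ which agrees with $\tau_0$ on each norm bounded subset of $\mathrm{Lip}_0(X)$. (ii) A subset $U$ of $\mathrm{Lip}_0(X)$ is open (respectively, closed) in $(\mathrm{Lip}_0(X),\tau_\gamma)$ if and only if $U\cap A$ is open (respectively, closed) in $(A,\tau_0)$ for each norm bounded subset $A$ of $\mathrm{Lip}_0(X)$. (iii) $\mathcal{F}(X)=(\mathrm{Lip}_0(X),\tau_\gamma)'_b=(\mathrm{Lip}_0(X),\tau_\gamma)'_c$. That is, a linear functional on $\mathrm{Lip}_0(X)$ belongs to $\mathcal{F}(X)$ if and only if it is $\tau_\gamma$-continuous, and the norm topology of $\mathcal{F}(X)$ coincides with the topologies of $(\mathrm{Lip}_0(X),\tau_\gamma)'_b$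 and of $(\mathrm{Lip}_0(X),\tau_\gamma)'_c$. (iv) The evaluation map $f\mapsto T_f$ is a topological isomorphism (a linear homeomorphism) from $(\mathrm{Lip}_0(X),\tau_\gamma)$ onto $\mathcal{F}(X)'_c$. -/

import Mathlib

open Topology Set
open scoped NNReal Pointwise

noncomputable section

namespace LipFree

section Space

/-- The scalar-valued Lipschitz functions on `X` that vanish at the base point `x₀`, as a linear
subspace of the space of all functions. -/
def lipSubmodule (𝕜 : Type*) [RCLike 𝕜] {X : Type*} [MetricSpace X] (x₀ : X) :
    Submodule 𝕜 (X → 𝕜) where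
  carrier := {f | (∃ C : ℝ≥0, LipschitzWith C f) ∧ f x₀ = 0}
  zero_mem' := ⟨⟨0, LipschitzWith.const 0⟩, rfl⟩
  add_mem' := by
    rintro f g ⟨⟨C, hC⟩, hf⟩ ⟨⟨D, hD⟩, hg⟩
    exact ⟨⟨C + D, hC.add hD⟩, by simp [hf, hg]⟩
  smul_mem' := by
    rintro c f ⟨⟨C, hC⟩, hf⟩
    refine ⟨⟨‖c‖₊ * C, ?_⟩, by simp [hf]⟩
    exact (lipschitzWith_smul c).comp hC

/-- The space `Lip₀(X)`.  It is a type of its own, so that it does not inherit the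
topology of pointwise convergence from the space of all functions. -/
def Lip₀ (𝕜 : Type*) [RCLike 𝕜] {X : Type*} [MetricSpace X] (x₀ : X) : Type _ :=
  lipSubmodule 𝕜 x₀

variable {𝕜 : Type*} [RCLike 𝕜] {X : Type*} [MetricSpace X] {x₀ : X}

namespace Lip₀

instance : AddCommGroup (Lip₀ 𝕜 x₀) := inferInstanceAs (AddCommGroup (lipSubmodule 𝕜 x₀))

instance : Module 𝕜 (Lip₀ 𝕜 x₀) := inferInstanceAs (Module 𝕜 (lipSubmodule 𝕜 x₀))

instance : Module ℝ (Lip₀ 𝕜 x₀) := inferInstanceAs (Module ℝ (lipSubmodule 𝕜 x₀))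

instance : IsScalarTower ℝ 𝕜 (Lip₀ 𝕜 x₀) :=
  inferInstanceAs (IsScalarTower ℝ 𝕜 (lipSubmodule 𝕜 x₀))

instance : CoeFun (Lip₀ 𝕜 x₀) (fun _ => X → 𝕜) := ⟨fun f => f.1⟩

theorem ext {f g : Lip₀ 𝕜 x₀} (h : ∀ x, f x = g x) : f = g := Subtype.ext (funext h)

@[simp] theorem zero_apply (x : X) : (0 : Lip₀ 𝕜 x₀) x = 0 := rfl
@[simp] theorem add_apply (f g : Lip₀ 𝕜 x₀) (x : X) : (f + g) x = f x + g x := rfl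
@[simp] theorem smul_apply (c : 𝕜) (f : Lip₀ 𝕜 x₀) (x : X) : (c • f) x = c * f x := rfl
@[simp] theorem apply_base (f : Lip₀ 𝕜 x₀) : f x₀ = 0 := f.2.2

theorem exists_lipschitz (f : Lip₀ 𝕜 x₀) : ∃ C : ℝ≥0, LipschitzWith C (f : X → 𝕜) := f.2.1

theorem continuous (f : Lip₀ 𝕜 x₀) : Continuous (f : X → 𝕜) :=
  let ⟨_, hC⟩ := f.exists_lipschitz
  hC.continuous

/-- The Lipschitz norm: the supremum of `|f x - f y| / d(x, y)` over all pairs `x ≠ y`. -/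
instance : Norm (Lip₀ 𝕜 x₀) :=
  ⟨fun f => ⨆ p : {p : X × X // p.1 ≠ p.2}, ‖f p.1.1 - f p.1.2‖ / dist p.1.1 p.1.2⟩

theorem norm_def (f : Lip₀ 𝕜 x₀) :
    ‖f‖ = ⨆ p : {p : X × X // p.1 ≠ p.2}, ‖f p.1.1 - f p.1.2‖ / dist p.1.1 p.1.2 := rfl

theorem bddAbove_quotients (f : Lip₀ 𝕜 x₀) :
    BddAbove (range fun p : {p : X × X // p.1 ≠ p.2} =>
      ‖f p.1.1 - f p.1.2‖ / dist p.1.1 p.1.2) := by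
  obtain ⟨C, hC⟩ := f.exists_lipschitz
  refine ⟨C, ?_⟩
  rintro _ ⟨p, rfl⟩
  have h := hC.dist_le_mul p.1.1 p.1.2
  rw [dist_eq_norm] at h
  exact (div_le_iff₀ (dist_pos.2 p.2)).2 h

theorem norm_nonneg' (f : Lip₀ 𝕜 x₀) : 0 ≤ ‖f‖ :=
  Real.iSup_nonneg fun _ => by positivity

theorem norm_sub_le_mul (f : Lip₀ 𝕜 x₀) (x y : X) : ‖f x - f y‖ ≤ ‖f‖ * dist x y := by
  rcases eq_or_ne x y with rfl | h
  · simp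
  · exact (div_le_iff₀ (dist_pos.2 h)).1 (le_ciSup f.bddAbove_quotients ⟨(x, y), h⟩)

theorem norm_le_of {f : Lip₀ 𝕜 x₀} {C : ℝ} (hC : 0 ≤ C)
    (h : ∀ x y, ‖f x - f y‖ ≤ C * dist x y) : ‖f‖ ≤ C :=
  Real.iSup_le (fun p => (div_le_iff₀ (dist_pos.2 p.2)).2 (h _ _)) hC

theorem norm_apply_le (f : Lip₀ 𝕜 x₀) (x : X) : ‖f x‖ ≤ dist x x₀ * ‖f‖ := by
  have h := f.norm_sub_le_mul x x₀
  rwa [apply_base, sub_zero, mul_comm] at h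

theorem norm_smul_le' (c : 𝕜) (f : Lip₀ 𝕜 x₀) : ‖c • f‖ ≤ ‖c‖ * ‖f‖ := by
  refine norm_le_of (mul_nonneg (norm_nonneg c) f.norm_nonneg') fun x y => ?_
  rw [smul_apply, smul_apply, ← mul_sub, norm_mul, mul_assoc]
  exact mul_le_mul_of_nonneg_left (f.norm_sub_le_mul x y) (norm_nonneg c)

theorem normCore : NormedSpace.Core 𝕜 (Lip₀ 𝕜 x₀) where
  norm_nonneg := norm_nonneg'
  norm_smul c f := by
    refine le_antisymm (norm_smul_le' c f) ?_
    rcases eq_or_ne c 0 with rfl | hc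
    · simpa using norm_nonneg' ((0 : 𝕜) • f)
    · have h := norm_smul_le' c⁻¹ (c • f)
      rw [smul_smul, inv_mul_cancel₀ hc, one_smul, norm_inv] at h
      rwa [inv_mul_eq_div, le_div_iff₀ (norm_pos_iff.2 hc), mul_comm] at h
  norm_triangle f g := by
    refine norm_le_of (add_nonneg f.norm_nonneg' g.norm_nonneg') fun x y => ?_
    rw [add_apply, add_apply, add_sub_add_comm, add_mul]
    exact (norm_add_le _ _).trans (add_le_add (f.norm_sub_le_mul x y) (g.norm_sub_le_mul x y))
  norm_eq_zero_iff f := by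
    constructor
    · intro h
      refine ext fun x => ?_
      have h' := f.norm_apply_le x
      rw [h, mul_zero] at h'
      exact norm_le_zero_iff.1 h'
    · rintro rfl
      exact le_antisymm (norm_le_of le_rfl (by simp)) (norm_nonneg' _)

instance : NormedAddCommGroup (Lip₀ 𝕜 x₀) := NormedAddCommGroup.ofCore normCore

instance : NormedSpace 𝕜 (Lip₀ 𝕜 x₀) := NormedSpace.ofCore normCore

/-- A function in `Lip₀(X)` as a bundled continuous function. -/
def toContinuousMap (f : Lip₀ 𝕜 x₀) : C(X, 𝕜) := ⟨f, f.continuous⟩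

end Lip₀

end Space

section Topologies

variable (𝕜 : Type*) [RCLike 𝕜] {X : Type*} [MetricSpace X] (x₀ : X)

/-- The compact-open topology `τ₀` on `Lip₀(X)`: uniform convergence on the compact subsets
of `X`. -/
abbrev tauZero : TopologicalSpace (Lip₀ 𝕜 x₀) :=
  TopologicalSpace.induced Lip₀.toContinuousMap ContinuousMap.compactOpen

variable {𝕜 x₀}

/-- For a sequence `U = (U₀, U₁, …)` of subsets of `Lip₀(X)`, the set
`γ(U) = ⋃ₙ (U₀ ∩ B + U₁ ∩ 2B + ⋯ + Uₙ ∩ 2ⁿB)`, where `B` is the closed unit ball of the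
Lipschitz norm. -/
def gammaSet (U : ℕ → Set (Lip₀ 𝕜 x₀)) : Set (Lip₀ 𝕜 x₀) :=
  ⋃ n : ℕ, ∑ i ∈ Finset.range (n + 1), (U i ∩ Metric.closedBall 0 (2 ^ i))

/-- `U` is a sequence of convex balanced `τ₀`-neighbourhoods of zero. -/
def IsGammaSeq (U : ℕ → Set (Lip₀ 𝕜 x₀)) : Prop :=
  ∀ n, Convex ℝ (U n) ∧ Balanced 𝕜 (U n) ∧ U n ∈ @nhds _ (tauZero 𝕜 x₀) 0

theorem mem_gammaSet {U : ℕ → Set (Lip₀ 𝕜 x₀)} {f : Lip₀ 𝕜 x₀} :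
    f ∈ gammaSet U ↔ ∃ (n : ℕ) (g : ℕ → Lip₀ 𝕜 x₀),
      (∀ i ∈ Finset.range n, g i ∈ U i ∧ ‖g i‖ ≤ 2 ^ i) ∧ 1 ≤ n ∧
        ∑ i ∈ Finset.range n, g i = f := by
  simp only [gammaSet, mem_iUnion, Set.mem_finsetSum]
  constructor
  · rintro ⟨n, g, hg, rfl⟩
    exact ⟨n + 1, g, fun i hi => by simpa using hg hi, by omega, rfl⟩
  · rintro ⟨n, g, hg, hn, rfl⟩
    obtain ⟨m, rfl⟩ : ∃ m, n = m + 1 := ⟨n - 1, by omega⟩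
    exact ⟨m, g, fun {i} hi => by simpa using hg i hi, rfl⟩

theorem IsGammaSeq.zero_mem {U : ℕ → Set (Lip₀ 𝕜 x₀)} (hU : IsGammaSeq U) (n : ℕ) :
    (0 : Lip₀ 𝕜 x₀) ∈ U n :=
  @mem_of_mem_nhds _ (tauZero 𝕜 x₀) _ _ (hU n).2.2

theorem IsGammaSeq.smul_preimage {U : Set (Lip₀ 𝕜 x₀)}
    (h : Convex ℝ U ∧ Balanced 𝕜 U ∧ U ∈ @nhds _ (tauZero 𝕜 x₀) 0) (c : 𝕜) :
    Convex ℝ ((fun f => c • f) ⁻¹' U) ∧ Balanced 𝕜 ((fun f => c • f) ⁻¹' U) ∧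
      (fun f => c • f) ⁻¹' U ∈ @nhds _ (tauZero 𝕜 x₀) 0 := by
  refine ⟨?_, ?_, ?_⟩
  · have := h.1.linear_preimage ((LinearMap.lsmul 𝕜 (Lip₀ 𝕜 x₀) c).restrictScalars ℝ)
    exact this
  · rw [balanced_iff_smul_mem]
    intro a ha f hf
    show c • a • f ∈ U
    rw [smul_comm]
    exact h.2.1.smul_mem ha hf
  · let := tauZero 𝕜 x₀
    have hc : Continuous (fun f : Lip₀ 𝕜 x₀ => c • f) := by
      rw [continuous_induced_rng]
      exact (continuous_const_smul c).comp (continuous_induced_dom :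
        Continuous (Lip₀.toContinuousMap : Lip₀ 𝕜 x₀ → C(X, 𝕜)))
    refine hc.continuousAt.preimage_mem_nhds ?_
    rw [smul_zero]
    exact h.2.2

theorem exists_two_pow_le (r : ℝ) : ∃ k : ℕ, r ≤ 2 ^ k := by
  obtain ⟨k, hk⟩ := pow_unbounded_of_one_lt r (one_lt_two : (1 : ℝ) < 2)
  exact ⟨k, hk.le⟩

variable (𝕜 x₀)

/-- The sets `γ(U)`, where `U` runs over the sequences of convex balanced
`τ₀`-neighbourhoods of zero, form a base of neighbourhoods of zero of a vector space topology. -/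
def gammaBasis : ModuleFilterBasis 𝕜 (Lip₀ 𝕜 x₀) where
  sets := {S | ∃ U, IsGammaSeq U ∧ S = gammaSet U}
  nonempty := ⟨_, fun _ => univ, fun _ => ⟨convex_univ, balanced_univ, Filter.univ_mem⟩, rfl⟩
  inter_sets := by
    rintro _ _ ⟨U, hU, rfl⟩ ⟨V, hV, rfl⟩
    refine ⟨_, ⟨fun n => U n ∩ V n, fun n => ⟨(hU n).1.inter (hV n).1,
      (hU n).2.1.inter (hV n).2.1, Filter.inter_mem (hU n).2.2 (hV n).2.2⟩, rfl⟩, ?_⟩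
    intro f hf
    obtain ⟨n, g, hg, hn, rfl⟩ := mem_gammaSet.1 hf
    exact ⟨mem_gammaSet.2 ⟨n, g, fun i hi => ⟨(hg i hi).1.1, (hg i hi).2⟩, hn, rfl⟩,
      mem_gammaSet.2 ⟨n, g, fun i hi => ⟨(hg i hi).1.2, (hg i hi).2⟩, hn, rfl⟩⟩
  zero' := by
    rintro _ ⟨U, hU, rfl⟩
    exact mem_gammaSet.2 ⟨1, 0, fun i _ => ⟨hU.zero_mem i, by simp⟩, le_rfl, by simp⟩
  add' := by
    rintro _ ⟨U, hU, rfl⟩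
    refine ⟨_, ⟨fun n => (fun f => (2 : 𝕜) • f) ⁻¹' U (n + 1),
      fun n => IsGammaSeq.smul_preimage (hU (n + 1)) 2, rfl⟩, ?_⟩
    rintro _ ⟨f, hf, g, hg, rfl⟩
    obtain ⟨n, a, ha, hn, rfl⟩ := mem_gammaSet.1 hf
    obtain ⟨m, b, hb, hm, rfl⟩ := mem_gammaSet.1 hg
    set a' : ℕ → Lip₀ 𝕜 x₀ := fun i => if i < n then a i else 0 with ha'
    set b' : ℕ → Lip₀ 𝕜 x₀ := fun i => if i < m then b i else 0 with hb'
    have key : ∀ (c : ℕ → Lip₀ 𝕜 x₀) (k : ℕ),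
        (∀ i ∈ Finset.range k, c i ∈ (fun f => (2 : 𝕜) • f) ⁻¹' U (i + 1) ∧ ‖c i‖ ≤ 2 ^ i) →
        ∀ i, (2 : 𝕜) • (if i < k then c i else 0) ∈ U (i + 1) ∧
          ‖if i < k then c i else 0‖ ≤ (2 : ℝ) ^ i := by
      intro c k hc i
      split_ifs with h
      · exact hc i (Finset.mem_range.2 h)
      · exact ⟨by simpa using hU.zero_mem (i + 1), by simp⟩
    have key2 : ∀ (c : ℕ → Lip₀ 𝕜 x₀) (k N : ℕ), k ≤ N →
        ∑ i ∈ Finset.range N, (if i < k then c i else 0) = ∑ i ∈ Finset.range k, c i := by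
      intro c k N hk
      rw [← Finset.sum_filter]
      congr 1
      ext i
      simp only [Finset.mem_filter, Finset.mem_range]
      omega
    refine mem_gammaSet.2 ⟨max n m + 1, fun i => Nat.casesOn i 0 fun i => a' i + b' i,
      ?_, by omega, ?_⟩
    · rintro (_ | i) -
      · exact ⟨hU.zero_mem 0, by simp⟩
      · have h1 := key a n ha i
        have h2 := key b m hb i
        refine ⟨?_, ?_⟩
        · have h3 := (hU (i + 1)).1 h1.1 h2.1 (by norm_num : (0 : ℝ) ≤ 1 / 2)
            (by norm_num : (0 : ℝ) ≤ 1 / 2) (by norm_num)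
          have h4 : ∀ f : Lip₀ 𝕜 x₀, (1 / 2 : ℝ) • (2 : 𝕜) • f = f := by
            intro f
            rw [← smul_assoc]
            have : ((1 / 2 : ℝ) • (2 : 𝕜)) = 1 := by
              rw [RCLike.real_smul_eq_coe_mul]
              push_cast
              norm_num
            rw [this, one_smul]
          rw [h4, h4] at h3
          exact h3
        · calc ‖a' i + b' i‖ ≤ ‖a' i‖ + ‖b' i‖ := norm_add_le _ _
            _ ≤ 2 ^ i + 2 ^ i := add_le_add h1.2 h2.2
            _ = 2 ^ (i + 1) := by ring
    · rw [Finset.sum_range_succ']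
      refine (add_zero _).trans ?_
      rw [Finset.sum_add_distrib, key2 a n _ (le_max_left _ _), key2 b m _ (le_max_right _ _)]
  neg' := by
    rintro _ ⟨U, hU, rfl⟩
    refine ⟨_, ⟨U, hU, rfl⟩, ?_⟩
    intro f hf
    obtain ⟨n, g, hg, hn, rfl⟩ := mem_gammaSet.1 hf
    exact mem_gammaSet.2 ⟨n, fun i => -g i, fun i hi => ⟨(hU i).2.1.neg_mem_iff.2 (hg i hi).1,
      by rw [norm_neg]; exact (hg i hi).2⟩, hn, by simp⟩
  conj' := by
    rintro f _ ⟨U, hU, rfl⟩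
    exact ⟨_, ⟨U, hU, rfl⟩, fun g hg => by simpa using hg⟩
  smul' := by
    rintro _ ⟨U, hU, rfl⟩
    refine ⟨_, Metric.closedBall_mem_nhds 0 one_pos, _, ⟨U, hU, rfl⟩, ?_⟩
    rintro _ ⟨c, hc, f, hf, rfl⟩
    have hc' : ‖c‖ ≤ 1 := by simpa using hc
    obtain ⟨n, g, hg, hn, rfl⟩ := mem_gammaSet.1 hf
    refine mem_gammaSet.2 ⟨n, fun i => c • g i, fun i hi =>
      ⟨(hU i).2.1.smul_mem hc' (hg i hi).1, ?_⟩, hn, by simp [Finset.smul_sum]⟩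
    rw [norm_smul]
    exact (mul_le_of_le_one_left (norm_nonneg _) hc').trans (hg i hi).2
  smul_left' := by
    rintro c _ ⟨U, hU, rfl⟩
    obtain ⟨k, hk⟩ := exists_two_pow_le ‖c‖
    refine ⟨_, ⟨fun n => (fun f => c • f) ⁻¹' U (n + k),
      fun n => IsGammaSeq.smul_preimage (hU (n + k)) c, rfl⟩, ?_⟩
    intro f hf
    obtain ⟨n, g, hg, hn, rfl⟩ := mem_gammaSet.1 hf
    refine mem_gammaSet.2 ⟨k + n, fun i => if i < k then 0 else c • g (i - k), ?_, by omega, ?_⟩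
    · intro i hi
      dsimp only
      split_ifs with h
      · exact ⟨hU.zero_mem i, by simp⟩
      · obtain ⟨j, rfl⟩ : ∃ j, i = j + k := ⟨i - k, by omega⟩
        have hj := hg j (by simp only [Finset.mem_range] at hi ⊢; omega)
        rw [Nat.add_sub_cancel]
        refine ⟨hj.1, ?_⟩
        rw [norm_smul, pow_add, mul_comm]
        exact mul_le_mul hj.2 hk (norm_nonneg _) (by positivity)
    · show _ = c • _
      rw [Finset.sum_range_add, Finset.smul_sum]
      have h1 : ∑ i ∈ Finset.range k, (if i < k then 0 else c • g (i - k)) = 0 :=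
        Finset.sum_eq_zero fun i hi => if_pos (Finset.mem_range.1 hi)
      rw [h1, zero_add]
      refine Finset.sum_congr rfl fun i _ => ?_
      simp
  smul_right' := by
    rintro f _ ⟨U, hU, rfl⟩
    obtain ⟨k, hk⟩ := exists_two_pow_le ‖f‖
    have h1 : ∀ᶠ c : 𝕜 in 𝓝 0, c • f ∈ U k := by
      let := tauZero 𝕜 x₀
      have hc : Continuous (fun c : 𝕜 => c • f) := by
        rw [continuous_induced_rng]
        have : Continuous fun c : 𝕜 => c • f.toContinuousMap := by fun_prop
        exact this
      refine hc.continuousAt.eventually_mem ?_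
      rw [zero_smul]
      exact (hU k).2.2
    filter_upwards [h1, Metric.closedBall_mem_nhds (0 : 𝕜) one_pos] with c hc hc1
    have hc1' : ‖c‖ ≤ 1 := by simpa using hc1
    refine mem_gammaSet.2 ⟨k + 1, fun i => if i = k then c • f else 0, ?_, by omega, by simp⟩
    intro i _
    dsimp only
    split_ifs with h
    · subst h
      refine ⟨hc, ?_⟩
      rw [norm_smul]
      exact (mul_le_of_le_one_left (norm_nonneg _) hc1').trans hk
    · exact ⟨hU.zero_mem i, by simp⟩

/-- The topology of bounded compact convergence `τ_γ` on `Lip₀(X)`, that is, the mixed topology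
`γ[Lip, τ₀]`: the vector space topology for which the sets `γ(U)` form a base of neighbourhoods
of zero. -/
abbrev tauGamma : TopologicalSpace (Lip₀ 𝕜 x₀) := (gammaBasis 𝕜 x₀).topology

variable {𝕜 x₀}

/-- The topologies `t` and `s` induce the same topology on every norm bounded set. -/
def AgreeOnBounded (t s : TopologicalSpace (Lip₀ 𝕜 x₀)) : Prop :=
  ∀ B : Set (Lip₀ 𝕜 x₀), Bornology.IsBounded B →
    TopologicalSpace.induced ((↑) : B → Lip₀ 𝕜 x₀) t =
      TopologicalSpace.induced ((↑) : B → Lip₀ 𝕜 x₀) s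

variable (𝕜 x₀)

/-- The topological vector space `(Lip₀(X), τ_γ)`, as a copy of the vector space `Lip₀(X)`. -/
def LipGamma : Type _ := Lip₀ 𝕜 x₀

instance : AddCommGroup (LipGamma 𝕜 x₀) := inferInstanceAs (AddCommGroup (Lip₀ 𝕜 x₀))

instance : Module 𝕜 (LipGamma 𝕜 x₀) := inferInstanceAs (Module 𝕜 (Lip₀ 𝕜 x₀))

instance : Module ℝ (LipGamma 𝕜 x₀) := inferInstanceAs (Module ℝ (Lip₀ 𝕜 x₀))

instance : IsScalarTower ℝ 𝕜 (LipGamma 𝕜 x₀) :=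
  inferInstanceAs (IsScalarTower ℝ 𝕜 (Lip₀ 𝕜 x₀))

instance : TopologicalSpace (LipGamma 𝕜 x₀) := tauGamma 𝕜 x₀

instance : IsTopologicalAddGroup (LipGamma 𝕜 x₀) :=
  (gammaBasis 𝕜 x₀).toAddGroupFilterBasis.isTopologicalAddGroup

instance : ContinuousSMul 𝕜 (LipGamma 𝕜 x₀) := (gammaBasis 𝕜 x₀).continuousSMul

/-- The identity map from `Lip₀(X)` to its copy with the topology `τ_γ`. -/
def toGamma : Lip₀ 𝕜 x₀ ≃ₗ[𝕜] LipGamma 𝕜 x₀ := LinearEquiv.refl 𝕜 (Lip₀ 𝕜 x₀)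

end Topologies

section Duals

variable (𝕜 : Type*) [RCLike 𝕜]

/-- `E'_b`: the continuous linear functionals on `E`, with the topology of uniform convergence
on the bounded subsets of `E`. -/
abbrev DualB (E : Type*) [AddCommGroup E] [Module 𝕜 E] [TopologicalSpace E] : Type _ :=
  UniformConvergenceCLM (RingHom.id 𝕜) 𝕜 {S : Set E | Bornology.IsVonNBounded 𝕜 S}

/-- `E'_c`: the continuous linear functionals on `E`, with the topology of uniform convergence
on the convex balanced compact subsets of `E`. -/
abbrev DualC (E : Type*) [AddCommGroup E] [Module 𝕜 E] [Module ℝ E] [TopologicalSpace E] :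
    Type _ :=
  UniformConvergenceCLM (RingHom.id 𝕜) 𝕜
    {S : Set E | Convex ℝ S ∧ Balanced 𝕜 S ∧ IsCompact S}

variable {X : Type*} [MetricSpace X] (x₀ : X)

/-- The evaluation functional `δ_x : f ↦ f x` on `Lip₀(X)` with the Lipschitz norm. -/
def dirac (x : X) : StrongDual 𝕜 (Lip₀ 𝕜 x₀) :=
  LinearMap.mkContinuous
    { toFun := fun f => f x
      map_add' := fun _ _ => rfl
      map_smul' := fun _ _ => rfl } (dist x x₀) fun f => f.norm_apply_le x

@[simp] theorem dirac_apply (x : X) (f : Lip₀ 𝕜 x₀) : dirac 𝕜 x₀ x f = f x := rfl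

/-- The Lipschitz-free space `F(X)`: the norm closed linear hull of the functionals `δ_x` in the
dual of `Lip₀(X)`. -/
def freeSpace : Submodule 𝕜 (StrongDual 𝕜 (Lip₀ 𝕜 x₀)) :=
  (Submodule.span 𝕜 (range (dirac 𝕜 x₀))).topologicalClosure

variable {𝕜 x₀}

/-- The operator `T_f : F(X) → 𝕜`, `T_f(φ) = φ(f)`. -/
def evalOp (f : Lip₀ 𝕜 x₀) : freeSpace 𝕜 x₀ →L[𝕜] 𝕜 :=
  (ContinuousLinearMap.apply 𝕜 𝕜 f).comp (freeSpace 𝕜 x₀).subtypeL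

@[simp] theorem evalOp_apply (f : Lip₀ 𝕜 x₀) (φ : freeSpace 𝕜 x₀) :
    evalOp f φ = (φ : StrongDual 𝕜 (Lip₀ 𝕜 x₀)) f := rfl

end Duals

end LipFree

end

noncomputable section

namespace LipFree

/-! ### Sets relatively open on norm balls, and compactness of the balls -/

section BoundedlyOpen

variable {𝕜 : Type*} [RCLike 𝕜] {X : Type*} [MetricSpace X] {x₀ : X}

/-! Everything rests on `isOpen_tauGamma_iff_boundedlyOpen`. Norm bounded sets are equi-Lipschitz,
so on them `τ₀` is pointwise convergence; hence `BoundedlyOpen` says that a set is relatively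
`τ₀`-open on every bounded set. That `τ_γ`-open sets have this property is easy, because `γ(U)`
contains each `U_k ∩ 2^k B`.

The converse is a Banach–Dieudonné argument. Balls are pointwise compact (Tychonoff), so a boundedly
open set containing `0` contains the polar of weighted molecules `t (δ_x - δ_y)` whose norms tend to
zero (`exists_molPolar_subset`). These form a totally bounded subset of `F(X)`. Conversely, the
polar of a totally bounded subset of `F(X)` contains some `γ(U)`: allow error `ε / 2^(i+1)` on the
ball of radius `2^i` and sum (`mem_nhds_tauGamma_of_totallyBounded`). So `τ_γ` is the topology of
uniform convergence on totally bounded subsets of `F(X)`, and (i) and (ii) are formal.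

For (iii), a functional pointwise continuous on the unit ball is norm close to the span of the
`δ_x`, by Hahn–Banach on a subspace of finite codimension. Banach–Steinhaus makes `τ_γ`-bounded sets
norm bounded, and the unit ball is convex, balanced and `τ_γ`-compact, so both dual topologies are
the norm topology. For (iv), a functional `l` on `F(X)` is evaluation at `x ↦ l(δ_x)`, and totally
bounded sets lie in convex balanced compact ones because `F(X)` is complete. -/

@[simp] theorem Lip₀.sub_apply (f g : Lip₀ 𝕜 x₀) (x : X) : (f - g) x = f x - g x := rfl
@[simp] theorem Lip₀.real_smul_apply (c : ℝ) (f : Lip₀ 𝕜 x₀) (x : X) : (c • f) x = c • f x := rfl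

theorem Lip₀.norm_apply_le_of_le {f : Lip₀ 𝕜 x₀} {r : ℝ} (hf : ‖f‖ ≤ r) (x : X) :
    ‖f x‖ ≤ r * dist x x₀ := by
  have h := f.norm_apply_le x
  rw [mul_comm] at h
  exact h.trans (mul_le_mul_of_nonneg_right hf dist_nonneg)

theorem nhds_tauZero_hasBasis (f : Lip₀ 𝕜 x₀) :
    (@nhds _ (tauZero 𝕜 x₀) f).HasBasis (fun p : Set X × ℝ => IsCompact p.1 ∧ 0 < p.2)
      (fun p => {g | ∀ x ∈ p.1, ‖g x - f x‖ ≤ p.2}) := by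
  rw [nhds_induced]
  have h := (nhds_basis_uniformity' (x := f.toContinuousMap)
    (Metric.uniformity_basis_dist_le (α := 𝕜).compactConvergenceUniformity (α := X))).comap
      (Lip₀.toContinuousMap (𝕜 := 𝕜) (x₀ := x₀))
  refine h.to_hasBasis ?_ ?_ <;>
  · rintro ⟨K, ε⟩ hK
    refine ⟨(K, ε), hK, fun g hg x hx => ?_⟩
    have := hg x hx
    simp only [dist_eq_norm'] at this ⊢
    exact this

/-- On bounded sets of functions, smallness on a compact set follows from smallness on a finite
set of points. -/
theorem exists_finset_forall_norm_le {K : Set X} (hK : IsCompact K) (r : ℝ) {ε : ℝ} (hε : 0 < ε) :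
    ∃ F : Finset X, ∃ δ > 0, ∀ g : Lip₀ 𝕜 x₀, ‖g‖ ≤ r → (∀ x ∈ F, ‖g x‖ ≤ δ) →
      ∀ x ∈ K, ‖g x‖ ≤ ε := by
  -- With this radius, moving to a nearby centre changes `g` by at most `ε / 2`; the `+ 1` keeps the
  -- denominator positive.
  obtain ⟨t, -, ht, hKt⟩ := hK.finite_cover_balls
    (e := ε / 2 / (|r| + 1)) (by positivity)
  refine ⟨ht.toFinset, ε / 2, by positivity, fun g hg hF x hx => ?_⟩
  obtain ⟨y, hy, hxy⟩ := mem_iUnion₂.1 (hKt hx)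
  have h1 := hF y (ht.mem_toFinset.2 hy)
  have h2 := g.norm_sub_le_mul x y
  have h3 : ‖g‖ * dist x y ≤ (|r| + 1) * (ε / 2 / (|r| + 1)) :=
    mul_le_mul (by linarith [le_abs_self r]) (Metric.mem_ball.1 hxy).le dist_nonneg (by positivity)
  rw [mul_div_cancel₀ _ (by positivity)] at h3
  have h4 := norm_sub_norm_le (g x) (g y)
  linarith

/-- Every point of `U` has a neighbourhood, in the topology of pointwise convergence relative to
each ball, that lies in `U`. -/
def BoundedlyOpen (U : Set (Lip₀ 𝕜 x₀)) : Prop :=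
  ∀ f ∈ U, ∀ r : ℝ, ∃ F : Finset X, ∃ δ > 0, ∀ g : Lip₀ 𝕜 x₀, ‖g‖ ≤ r →
    (∀ x ∈ F, ‖g x‖ ≤ δ) → f + g ∈ U

theorem boundedlyOpen_iff_forall_isOpen {U : Set (Lip₀ 𝕜 x₀)} :
    BoundedlyOpen U ↔ ∀ B : Set (Lip₀ 𝕜 x₀), Bornology.IsBounded B →
      IsOpen[TopologicalSpace.induced ((↑) : B → Lip₀ 𝕜 x₀) (tauZero 𝕜 x₀)]
        ((↑) ⁻¹' U : Set B) := by
  constructor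
  · intro hU B hB
    obtain ⟨R, hR⟩ := hB.exists_norm_le
    let t : TopologicalSpace B := TopologicalSpace.induced ((↑) : B → Lip₀ 𝕜 x₀) (tauZero 𝕜 x₀)
    refine isOpen_iff_mem_nhds.2 fun f hf => ?_
    obtain ⟨F, δ, hδ, h⟩ := hU f hf (R + R)
    rw [@nhds_induced _ _ (tauZero 𝕜 x₀)]
    refine ⟨_, (nhds_tauZero_hasBasis (f : Lip₀ 𝕜 x₀)).mem_of_mem (i := ((F : Set X), δ))
      ⟨F.finite_toSet.isCompact, hδ⟩, fun g hg => ?_⟩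
    have := h (g - f) ((norm_sub_le _ _).trans (add_le_add (hR _ g.2) (hR _ f.2)))
      fun x hx => hg x hx
    rwa [add_sub_cancel] at this
  · intro h f hf r
    -- This ball contains both `f` and every `f + g` with `‖g‖ ≤ r`.
    obtain ⟨W, hW, hWU⟩ := h _ (Metric.isBounded_closedBall (x := (0 : Lip₀ 𝕜 x₀)) (r := ‖f‖ + |r|))
    have hfW : f ∈ W := by
      have : (⟨f, by simp⟩ : Metric.closedBall (0 : Lip₀ 𝕜 x₀) (‖f‖ + |r|)) ∈
        (Subtype.val ⁻¹' U : Set (Metric.closedBall (0 : Lip₀ 𝕜 x₀) (‖f‖ + |r|))) := hf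
      rwa [← hWU] at this
    obtain ⟨⟨K, ε⟩, ⟨hK, hε⟩, hKW⟩ := (nhds_tauZero_hasBasis f).mem_iff.1
      ((@isOpen_iff_mem_nhds _ (tauZero 𝕜 x₀) W).1 hW f hfW)
    obtain ⟨F, δ, hδ, hF⟩ := exists_finset_forall_norm_le (𝕜 := 𝕜) (x₀ := x₀) hK r hε
    refine ⟨F, δ, hδ, fun g hg hgF => ?_⟩
    have hW' : f + g ∈ W := hKW fun x hx => by simpa using hF g hg hgF x hx
    have hfg : f + g ∈ Metric.closedBall (0 : Lip₀ 𝕜 x₀) (‖f‖ + |r|) := by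
      rw [mem_closedBall_zero_iff]
      exact (norm_add_le f g).trans (add_le_add le_rfl (hg.trans (le_abs_self r)))
    have : (⟨f + g, hfg⟩ :
        Metric.closedBall (0 : Lip₀ 𝕜 x₀) (‖f‖ + |r|)) ∈
        (Subtype.val ⁻¹' W : Set (Metric.closedBall (0 : Lip₀ 𝕜 x₀) (‖f‖ + |r|))) := hW'
    rwa [hWU] at this

theorem BoundedlyOpen.preimage_add {U : Set (Lip₀ 𝕜 x₀)} (hU : BoundedlyOpen U)
    (f : Lip₀ 𝕜 x₀) : BoundedlyOpen ((fun g => f + g) ⁻¹' U) := by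
  intro g hg r
  obtain ⟨F, δ, hδ, h⟩ := hU _ hg r
  exact ⟨F, δ, hδ, fun k hk hkF => by simpa [add_assoc] using h k hk hkF⟩

/-- Evaluations are norm continuous, so the finitely many pointwise conditions hold near `f` in
norm. Hence `τ_γ` will be coarser than the norm topology. -/
theorem BoundedlyOpen.isOpen {U : Set (Lip₀ 𝕜 x₀)} (hU : BoundedlyOpen U) : IsOpen U := by
  refine isOpen_iff_mem_nhds.2 fun f hf => ?_
  obtain ⟨F, δ, hδ, h⟩ := hU f hf 1
  have h1 : ∀ᶠ g in 𝓝 f, ‖g - f‖ < 1 :=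
    (by fun_prop : Continuous fun g : Lip₀ 𝕜 x₀ => ‖g - f‖).continuousAt.eventually_lt_const
      (by simp)
  have h2 : ∀ᶠ g in 𝓝 f, ∀ x ∈ F, ‖dirac 𝕜 x₀ x (g - f)‖ < δ :=
    (Finset.eventually_all F).2 fun x _ =>
      (by fun_prop : Continuous fun g : Lip₀ 𝕜 x₀ =>
        ‖dirac 𝕜 x₀ x (g - f)‖).continuousAt.eventually_lt_const (by simpa using hδ)
  filter_upwards [h1, h2] with g hg1 hg2
  simpa using h (g - f) hg1.le fun x hx => (hg2 x hx).le

theorem continuous_lipSubmodule_apply (x : X) :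
    Continuous fun f : lipSubmodule 𝕜 x₀ => (f : X → 𝕜) x :=
  (continuous_apply x).comp continuous_subtype_val

/-- The closed balls of `Lip₀(X)` are compact in the topology of pointwise convergence. -/
theorem isCompact_closedBall_pointwise (r : ℝ) :
    IsCompact (X := lipSubmodule 𝕜 x₀) {f | ‖(show Lip₀ 𝕜 x₀ from f)‖ ≤ r} := by
  rcases lt_or_ge r 0 with hr | hr
  · convert isCompact_empty (X := lipSubmodule 𝕜 x₀)
    exact eq_empty_of_forall_notMem fun f hf =>
      (hr.trans_le (Lip₀.norm_nonneg' (show Lip₀ 𝕜 x₀ from f))).not_ge hf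
  rw [Subtype.isCompact_iff]
  have h1 : IsCompact (univ.pi fun x : X => Metric.closedBall (0 : 𝕜) (r * dist x x₀)) :=
    isCompact_univ_pi fun x => isCompact_closedBall _ _
  have h2 : IsClosed {f : X → 𝕜 | ∀ x y, ‖f x - f y‖ ≤ r * dist x y} := by
    simp only [ofPred_forall]
    exact isClosed_iInter fun x => isClosed_iInter fun y =>
      isClosed_le (by fun_prop) continuous_const
  convert h1.inter_right h2 using 1
  ext f
  constructor
  · rintro ⟨g, hg, rfl⟩
    refine ⟨fun x _ => ?_, fun x y => ?_⟩
    · simpa using Lip₀.norm_apply_le_of_le hg x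
    · exact (Lip₀.norm_sub_le_mul (show Lip₀ 𝕜 x₀ from g) x y).trans
        (mul_le_mul_of_nonneg_right hg dist_nonneg)
  · rintro ⟨hf1, hf2⟩
    have hf0 : f x₀ = 0 := by simpa using hf1 x₀ (mem_univ _)
    exact ⟨⟨f, ⟨r.toNNReal, LipschitzWith.of_dist_le_mul fun x y => by
      simpa [dist_eq_norm, hr] using hf2 x y⟩, hf0⟩, Lip₀.norm_le_of hr hf2, rfl⟩

/-- A boundedly open set is relatively open on each ball for pointwise convergence. -/
theorem BoundedlyOpen.eventually_mem {U : Set (Lip₀ 𝕜 x₀)} (hU : BoundedlyOpen U)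
    {f : lipSubmodule 𝕜 x₀} (hf : (show Lip₀ 𝕜 x₀ from f) ∈ U) (r : ℝ) :
    ∀ᶠ g : lipSubmodule 𝕜 x₀ in 𝓝 f, ‖(show Lip₀ 𝕜 x₀ from g)‖ ≤ r →
      (show Lip₀ 𝕜 x₀ from g) ∈ U := by
  obtain ⟨F, δ, hδ, h⟩ := hU _ hf (r + ‖(show Lip₀ 𝕜 x₀ from f)‖)
  have h2 : ∀ᶠ g : lipSubmodule 𝕜 x₀ in 𝓝 f, ∀ x ∈ F, ‖g.1 x - f.1 x‖ < δ :=
    (Finset.eventually_all F).2 fun x _ =>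
      ((continuous_lipSubmodule_apply x).sub continuous_const).norm.continuousAt.eventually_lt_const (by simpa using hδ)
  filter_upwards [h2] with g hg hgr
  have := h ((show Lip₀ 𝕜 x₀ from g) - (show Lip₀ 𝕜 x₀ from f))
    ((norm_sub_le _ _).trans (add_le_add hgr le_rfl)) fun x hx => (hg x hx).le
  rwa [add_sub_cancel] at this

end BoundedlyOpen

/-! ### The Banach–Dieudonné construction -/

section Polar

variable {𝕜 : Type*} [RCLike 𝕜] {X : Type*} [MetricSpace X] {x₀ : X}

/-- The polar of a set of weighted elementary molecules `t (δ_x - δ_y)`. -/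
def molPolar (𝕜 : Type*) [RCLike 𝕜] (x₀ : X) (S : Set (ℝ × X × X)) : Set (Lip₀ 𝕜 x₀) :=
  {f | ∀ p ∈ S, ‖p.1 • (f p.2.1 - f p.2.2)‖ ≤ 1}

/-- The molecules of weight at most `1 / c` norm the ball of radius `c`. They are the infinite
family from which compactness extracts a finite one. -/
theorem norm_le_of_mem_molPolar {f : Lip₀ 𝕜 x₀} {c : ℝ} (hc : 0 ≤ c)
    (hf : f ∈ molPolar 𝕜 x₀ {p | c * (|p.1| * dist p.2.1 p.2.2) ≤ 1}) : ‖f‖ ≤ c := by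
  refine Lip₀.norm_le_of hc fun x y => ?_
  by_contra! h
  -- The weight `s⁻¹` is small enough to be admissible yet makes the molecule exceed `1` on `f`.
  obtain ⟨s, hs, hs'⟩ := exists_between h
  have hs0 : 0 < s := lt_of_le_of_lt (by positivity) hs
  have := hf (s⁻¹, x, y) (by
    rw [mem_ofPred_eq, abs_of_pos (inv_pos.2 hs0), mul_left_comm, inv_mul_le_iff₀ hs0]
    linarith)
  rw [norm_smul, norm_inv, Real.norm_of_nonneg hs0.le, inv_mul_le_iff₀ hs0] at this
  linarith

/-- The part of the polar of `S` in the ball of radius `m + 1` that lies outside `U` is pointwise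
compact. Adding all molecules with `m * weight ≤ 1` would force the norm down to `m`, where the
hypothesis applies, so the intersection is empty; finitely many of them already suffice. -/
theorem BoundedlyOpen.exists_molPolar_step {U : Set (Lip₀ 𝕜 x₀)} (hU : BoundedlyOpen U) (m : ℕ)
    (S : Set (ℝ × X × X)) (hS : ∀ f ∈ molPolar 𝕜 x₀ S, ‖f‖ ≤ m → f ∈ U) :
    ∃ A : Finset (ℝ × X × X), (∀ p ∈ A, m * (|p.1| * dist p.2.1 p.2.2) ≤ 1) ∧
      ∀ f ∈ molPolar 𝕜 x₀ (S ∪ A), ‖f‖ ≤ (m + 1 : ℕ) → f ∈ U := by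
  have hcl : ∀ p : ℝ × X × X,
      IsClosed {f : lipSubmodule 𝕜 x₀ | ‖p.1 • (f.1 p.2.1 - f.1 p.2.2)‖ ≤ 1} := fun p =>
    isClosed_le (((continuous_lipSubmodule_apply _).sub
      (continuous_lipSubmodule_apply _)).const_smul p.1).norm continuous_const
  set Bm : Set (lipSubmodule 𝕜 x₀) := {f | ‖(show Lip₀ 𝕜 x₀ from f)‖ ≤ (m + 1 : ℕ)} with hBm
  have hB : IsCompact Bm := isCompact_closedBall_pointwise _
  have hBU : IsClosed (Bm ∩ {f | (show Lip₀ 𝕜 x₀ from f) ∉ U}) := by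
    rw [← isOpen_compl_iff, isOpen_iff_mem_nhds]
    intro f hf
    by_cases hfB : f ∈ Bm
    · have hfU : (show Lip₀ 𝕜 x₀ from f) ∈ U := by
        by_contra h
        exact hf ⟨hfB, h⟩
      filter_upwards [hU.eventually_mem hfU (m + 1 : ℕ)] with g hg hg'
      exact hg'.2 (hg hg'.1)
    · filter_upwards [hB.isClosed.isOpen_compl.mem_nhds hfB] with g hg hg'
      exact hg hg'.1
  have hQ : IsCompact ((Bm ∩ {f | (show Lip₀ 𝕜 x₀ from f) ∉ U}) ∩
      ⋂ p ∈ S, {f : lipSubmodule 𝕜 x₀ | ‖p.1 • (f.1 p.2.1 - f.1 p.2.2)‖ ≤ 1}) :=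
    (hB.of_isClosed_subset hBU inter_subset_left).inter_right
      (isClosed_biInter fun p _ => hcl p)
  obtain ⟨u, hu⟩ := hQ.elim_finite_subfamily_closed
    (fun p : {p : ℝ × X × X // m * (|p.1| * dist p.2.1 p.2.2) ≤ 1} =>
      {f : lipSubmodule 𝕜 x₀ | ‖p.1.1 • (f.1 p.1.2.1 - f.1 p.1.2.2)‖ ≤ 1}) (fun p => hcl p) (by
      refine eq_empty_of_forall_notMem fun f hf => ?_
      obtain ⟨⟨⟨-, hfU⟩, hfS⟩, hfm⟩ := hf
      refine hfU (hS f (fun p hp => mem_iInter₂.1 hfS p hp)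
        (norm_le_of_mem_molPolar m.cast_nonneg fun p hp => mem_iInter.1 hfm ⟨p, hp⟩)))
  refine ⟨u.map (Function.Embedding.subtype _), fun p hp => ?_, fun f hf hfm => ?_⟩
  · obtain ⟨q, -, rfl⟩ := Finset.mem_map.1 hp
    exact q.2
  · by_contra hfU
    have : (show lipSubmodule 𝕜 x₀ from f) ∈ (∅ : Set (lipSubmodule 𝕜 x₀)) := by
      rw [← hu]
      refine ⟨⟨⟨hfm, hfU⟩, mem_iInter₂.2 fun p hp => hf p (Or.inl hp)⟩,
        mem_iInter₂.2 fun p hp => hf p.1 (Or.inr ?_)⟩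
      exact Finset.mem_coe.2 (Finset.mem_map_of_mem _ hp)
    exact this

/-- The argument of the Banach–Dieudonné theorem: a boundedly open set that contains `0` contains
the polar of a null sequence of weighted elementary molecules. -/
theorem BoundedlyOpen.exists_molPolar_subset {U : Set (Lip₀ 𝕜 x₀)} (hU : BoundedlyOpen U)
    (h0 : 0 ∈ U) : ∃ S : Set (ℝ × X × X),
      (∀ ε > 0, {p ∈ S | ε < |p.1| * dist p.2.1 p.2.2}.Finite) ∧ molPolar 𝕜 x₀ S ⊆ U := by
  have step : ∀ (m : ℕ) (S : Set (ℝ × X × X)), ∃ A : Finset (ℝ × X × X),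
      (∀ p ∈ A, m * (|p.1| * dist p.2.1 p.2.2) ≤ 1) ∧
        ((∀ f ∈ molPolar 𝕜 x₀ S, ‖f‖ ≤ m → f ∈ U) →
          ∀ f ∈ molPolar 𝕜 x₀ (S ∪ A), ‖f‖ ≤ (m + 1 : ℕ) → f ∈ U) := by
    intro m S
    -- The empty set is a default that makes the step total, so that `choose` can drive the
    -- recursion.
    by_cases h : ∀ f ∈ molPolar 𝕜 x₀ S, ‖f‖ ≤ m → f ∈ U
    · obtain ⟨A, hA, hA'⟩ := hU.exists_molPolar_step m S h
      exact ⟨A, hA, fun _ => hA'⟩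
    · exact ⟨∅, by simp, fun h' => absurd h' h⟩
  choose A hA hA' using step
  let S : ℕ → Set (ℝ × X × X) := fun n => Nat.rec ∅ (fun m T => T ∪ A m T) n
  have hS : ∀ n, S (n + 1) = S n ∪ A n (S n) := fun n => rfl
  have hU' : ∀ n, ∀ f ∈ molPolar 𝕜 x₀ (S n), ‖f‖ ≤ n → f ∈ U := by
    intro n
    induction n with
    | zero =>
      intro f _ hf
      rw [Nat.cast_zero, norm_le_zero_iff] at hf
      rwa [hf]
    | succ n ih => exact hA' n (S n) ih
  have hfin : ∀ n, (S n).Finite := by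
    intro n
    induction n with
    | zero => exact finite_empty
    | succ n ih => exact ih.union (Finset.finite_toSet _)
  -- Molecules added from stage `N` on have weight at most `1 / N`; all others lie in the finite set
  -- `S N`.
  have htail : ∀ N n, ∀ p ∈ S n, p ∈ S N ∨ N * (|p.1| * dist p.2.1 p.2.2) ≤ 1 := by
    intro N n
    have hmono : Monotone S := monotone_nat_of_le_succ fun n => subset_union_left
    induction n with
    | zero => exact fun p hp => hp.elim
    | succ n ih =>
      rintro p (hp | hp)
      · exact ih p hp
      · rcases Nat.lt_or_ge n N with h | h
        · exact Or.inl (hmono h (Or.inr hp))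
        · refine Or.inr (le_trans ?_ (hA n (S n) p hp))
          gcongr
  refine ⟨⋃ n, S n, fun ε hε => ?_, fun f hf => ?_⟩
  · obtain ⟨N, hN⟩ := exists_nat_gt ε⁻¹
    refine (hfin N).subset ?_
    rintro p ⟨hp, hpε⟩
    obtain ⟨n, hn⟩ := mem_iUnion.1 hp
    refine (htail N n p hn).resolve_right fun h => ?_
    have h1 : 1 < N * ε := (inv_lt_iff_one_lt_mul₀ hε).1 hN
    have h2 : N * ε ≤ N * (|p.1| * dist p.2.1 p.2.2) := by gcongr
    linarith
  · obtain ⟨n, hn⟩ := exists_nat_ge ‖f‖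
    exact hU' n f (fun p hp => hf p (mem_iUnion_of_mem n hp)) hn

end Polar

/-! ### Polars of totally bounded sets and the open sets of `τ_γ` -/

section Gamma

variable {𝕜 : Type*} [RCLike 𝕜] {X : Type*} [MetricSpace X] {x₀ : X}

theorem nhds_tauGamma_hasBasis (f : Lip₀ 𝕜 x₀) :
    (@nhds _ (tauGamma 𝕜 x₀) f).HasBasis (IsGammaSeq (𝕜 := 𝕜) (x₀ := x₀))
      (fun U => (fun g => f + g) '' gammaSet U) := by
  refine ((gammaBasis 𝕜 x₀).toAddGroupFilterBasis.nhds_hasBasis f).to_hasBasis ?_ ?_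
  · rintro _ ⟨U, hU, rfl⟩
    exact ⟨U, hU, subset_rfl⟩
  · intro U hU
    exact ⟨_, ⟨U, hU, rfl⟩, subset_rfl⟩

theorem gammaSeq_norm_le (F : Finset X) {δ : ℝ} (hδ : 0 < δ) :
    Convex ℝ {f : Lip₀ 𝕜 x₀ | ∀ x ∈ F, ‖f x‖ ≤ δ} ∧
      Balanced 𝕜 {f : Lip₀ 𝕜 x₀ | ∀ x ∈ F, ‖f x‖ ≤ δ} ∧
      {f : Lip₀ 𝕜 x₀ | ∀ x ∈ F, ‖f x‖ ≤ δ} ∈ @nhds _ (tauZero 𝕜 x₀) 0 := by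
  refine ⟨fun f hf g hg a b ha hb hab x hx => ?_, balanced_iff_smul_mem.2 fun {a} ha f hf x hx => ?_,
    ?_⟩
  · have h := convex_closedBall (0 : 𝕜) δ (by simpa using hf x hx) (by simpa using hg x hx)
      ha hb hab
    simpa using h
  · rw [Lip₀.smul_apply, norm_mul]
    exact (mul_le_of_le_one_left (norm_nonneg _) ha).trans (hf x hx)
  · simpa using (nhds_tauZero_hasBasis (0 : Lip₀ 𝕜 x₀)).mem_of_mem (i := ((F : Set X), δ))
      ⟨F.finite_toSet.isCompact, hδ⟩

/-- The polar of a set of functionals that is equicontinuous at `0` on each ball, for the topology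
of pointwise convergence, is a `τ_γ`-neighbourhood of `0`. -/
theorem setOf_forall_norm_le_mem_nhds_tauGamma {Φ : Set (StrongDual 𝕜 (Lip₀ 𝕜 x₀))}
    (hΦ : ∀ r : ℝ, ∀ ε > 0, ∃ F : Finset X, ∃ δ > 0, ∀ f : Lip₀ 𝕜 x₀, ‖f‖ ≤ r →
      (∀ x ∈ F, ‖f x‖ ≤ δ) → ∀ φ ∈ Φ, ‖φ f‖ ≤ ε) {ε : ℝ} (hε : 0 < ε) :
    {f : Lip₀ 𝕜 x₀ | ∀ φ ∈ Φ, ‖φ f‖ ≤ ε} ∈ @nhds _ (tauGamma 𝕜 x₀) 0 := by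
  -- The tolerances on the balls of radius `2^i` form a geometric series with sum `ε`.
  choose F δ hδ h using fun i : ℕ => hΦ (2 ^ i) (ε / 2 / 2 ^ i) (by positivity)
  refine (nhds_tauGamma_hasBasis (0 : Lip₀ 𝕜 x₀)).mem_iff.2
    ⟨fun i => {f | ∀ x ∈ F i, ‖f x‖ ≤ δ i}, fun i => gammaSeq_norm_le (F i) (hδ i), ?_⟩
  rintro _ ⟨f, hf, rfl⟩ φ hφ
  obtain ⟨n, g, hg, -, rfl⟩ := mem_gammaSet.1 hf
  show ‖φ (0 + _)‖ ≤ ε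
  rw [zero_add, map_sum]
  calc ‖∑ i ∈ Finset.range n, φ (g i)‖ ≤ ∑ i ∈ Finset.range n, ε / 2 / 2 ^ i :=
        norm_sum_le_of_le _ fun i hi => h i (g i) (hg i hi).2 (hg i hi).1 φ hφ
    _ ≤ ∑' i : ℕ, ε / 2 / 2 ^ i :=
        (summable_geometric_two' ε).sum_le_tsum _ fun i _ => by positivity
    _ = ε := tsum_geometric_two' ε

/-- The norm of the free space. -/
@[reducible] def freeSpaceSeminormedAddCommGroup : SeminormedAddCommGroup (freeSpace 𝕜 x₀) :=
  (freeSpace 𝕜 x₀).normedAddCommGroup.toSeminormedAddCommGroup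

attribute [local instance] freeSpaceSeminormedAddCommGroup

/-- The free space is a normed space. -/
@[reducible] def freeSpaceNormedSpace : NormedSpace 𝕜 (freeSpace 𝕜 x₀) :=
  (freeSpace 𝕜 x₀).normedSpace

attribute [local instance] freeSpaceNormedSpace

/-- Elements of the free space are continuous on balls for the topology of pointwise
convergence. -/
theorem exists_finset_forall_norm_apply_le {φ : StrongDual 𝕜 (Lip₀ 𝕜 x₀)}
    (hφ : φ ∈ freeSpace 𝕜 x₀) (r : ℝ) {ε : ℝ} (hε : 0 < ε) :
    ∃ F : Finset X, ∃ δ > 0, ∀ f : Lip₀ 𝕜 x₀, ‖f‖ ≤ r → (∀ x ∈ F, ‖f x‖ ≤ δ) → ‖φ f‖ ≤ ε := by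
  classical
  have hspan : ∀ ψ ∈ Submodule.span 𝕜 (range (dirac 𝕜 x₀)), ∀ ε > 0,
      ∃ F : Finset X, ∃ δ > 0, ∀ f : Lip₀ 𝕜 x₀, (∀ x ∈ F, ‖f x‖ ≤ δ) → ‖ψ f‖ ≤ ε := by
    intro ψ hψ
    induction hψ using Submodule.span_induction with
    | mem ψ h =>
      obtain ⟨x, rfl⟩ := h
      exact fun ε hε => ⟨{x}, ε, hε, fun f hf => by simpa using hf⟩
    | zero => exact fun ε hε => ⟨∅, 1, one_pos, fun f _ => by simpa using hε.le⟩
    | add ψ χ _ _ hψ hχ =>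
      intro ε hε
      obtain ⟨F, δ, hδ, h⟩ := hψ (ε / 2) (by positivity)
      obtain ⟨G, η, hη, h'⟩ := hχ (ε / 2) (by positivity)
      refine ⟨F ∪ G, min δ η, lt_min hδ hη, fun f hf => ?_⟩
      have h1 := h f fun x hx => (hf x (Finset.mem_union_left _ hx)).trans (min_le_left _ _)
      have h2 := h' f fun x hx => (hf x (Finset.mem_union_right _ hx)).trans (min_le_right _ _)
      exact (norm_add_le (ψ f) (χ f)).trans (by linarith)
    | smul c ψ _ hψ =>
      intro ε hε
      obtain ⟨F, δ, hδ, h⟩ := hψ (ε / (‖c‖ + 1)) (by positivity)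
      refine ⟨F, δ, hδ, fun f hf => ?_⟩
      rw [smul_apply, norm_smul]
      calc ‖c‖ * ‖ψ f‖ ≤ (‖c‖ + 1) * (ε / (‖c‖ + 1)) :=
            mul_le_mul (by linarith) (h f hf) (norm_nonneg _) (by positivity)
        _ = ε := mul_div_cancel₀ _ (by positivity)
  obtain ⟨ψ, hψ, hd⟩ := Metric.mem_closure_iff.1 hφ (ε / 2 / (|r| + 1)) (by positivity)
  obtain ⟨F, δ, hδ, h⟩ := hspan ψ hψ (ε / 2) (by positivity)
  refine ⟨F, δ, hδ, fun f hfr hf => ?_⟩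
  have h1 := h f hf
  have h2 : ‖(φ - ψ) f‖ ≤ ε / 2 / (|r| + 1) * (|r| + 1) :=
    (φ - ψ).le_of_opNorm_le_of_le (by rw [← dist_eq_norm]; exact hd.le)
      (hfr.trans (by linarith [le_abs_self r]))
  rw [div_mul_cancel₀ _ (by positivity), sub_apply] at h2
  have h3 := norm_sub_norm_le (φ f) (ψ f)
  linarith

/-- The polar of a totally bounded subset of the free space is a `τ_γ`-neighbourhood of `0`. -/
theorem mem_nhds_tauGamma_of_totallyBounded {K : Set (freeSpace 𝕜 x₀)} (hK : TotallyBounded K)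
    {ε : ℝ} (hε : 0 < ε) :
    {f : Lip₀ 𝕜 x₀ | ∀ φ ∈ K, ‖evalOp f φ‖ ≤ ε} ∈ @nhds _ (tauGamma 𝕜 x₀) 0 := by
  classical
  have := setOf_forall_norm_le_mem_nhds_tauGamma (x₀ := x₀)
    (Φ := ((↑) : freeSpace 𝕜 x₀ → StrongDual 𝕜 (Lip₀ 𝕜 x₀)) '' K) ?_ hε
  · simpa using this
  intro r ε hε
  obtain ⟨t, ht, hKt⟩ := Metric.totallyBounded_iff.1 hK (ε / 2 / (|r| + 1)) (by positivity)
  choose F δ hδ h using fun φ : freeSpace 𝕜 x₀ =>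
    exists_finset_forall_norm_apply_le φ.2 r (half_pos hε)
  -- A common tolerance for the finite net; the value `1` serves when the net is empty.
  obtain ⟨η, hη, hηδ⟩ : ∃ η > 0, ∀ φ ∈ ht.toFinset, η ≤ δ φ := by
    rcases ht.toFinset.eq_empty_or_nonempty with h0 | h0
    · exact ⟨1, one_pos, by simp [h0]⟩
    · obtain ⟨φ, hφ, hmin⟩ := ht.toFinset.exists_min_image δ h0
      exact ⟨δ φ, hδ φ, hmin⟩
  refine ⟨ht.toFinset.biUnion F, η, hη, fun f hfr hf => ?_⟩
  rintro _ ⟨φ, hφ, rfl⟩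
  obtain ⟨ψ, hψ, hd⟩ := mem_iUnion₂.1 (hKt hφ)
  have hψ' := ht.mem_toFinset.2 hψ
  have h1 := h ψ f hfr fun x hx =>
    (hf x (Finset.mem_biUnion.2 ⟨ψ, hψ', hx⟩)).trans (hηδ ψ hψ')
  have h2 : ‖((φ : StrongDual 𝕜 (Lip₀ 𝕜 x₀)) - ψ) f‖ ≤ ε / 2 / (|r| + 1) * (|r| + 1) :=
    ContinuousLinearMap.le_of_opNorm_le_of_le _
      (by rw [← dist_eq_norm]; exact (Metric.mem_ball.1 hd).le)
      (hfr.trans (by linarith [le_abs_self r]))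
  rw [div_mul_cancel₀ _ (by positivity), sub_apply] at h2
  have h3 := norm_sub_norm_le ((φ : StrongDual 𝕜 (Lip₀ 𝕜 x₀)) f)
    ((ψ : StrongDual 𝕜 (Lip₀ 𝕜 x₀)) f)
  linarith

theorem dirac_mem_freeSpace (x : X) : dirac 𝕜 x₀ x ∈ freeSpace 𝕜 x₀ :=
  Submodule.le_topologicalClosure _ (Submodule.subset_span ⟨x, rfl⟩)

variable (𝕜 x₀) in
/-- The evaluation functionals as elements of the free space. -/
def freeDirac (x : X) : freeSpace 𝕜 x₀ := ⟨dirac 𝕜 x₀ x, dirac_mem_freeSpace x⟩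

theorem norm_freeDirac_sub_le (x y : X) :
    ‖freeDirac 𝕜 x₀ x - freeDirac 𝕜 x₀ y‖ ≤ dist x y := by
  refine ContinuousLinearMap.opNorm_le_bound _ dist_nonneg fun f => ?_
  rw [mul_comm]
  exact f.norm_sub_le_mul x y

/-- The weighted elementary molecule `t (δ_x - δ_y)`. -/
def molecule (𝕜 : Type*) [RCLike 𝕜] (x₀ : X) (p : ℝ × X × X) : freeSpace 𝕜 x₀ :=
  (p.1 : 𝕜) • (freeDirac 𝕜 x₀ p.2.1 - freeDirac 𝕜 x₀ p.2.2)

theorem norm_molecule_le (p : ℝ × X × X) :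
    ‖molecule 𝕜 x₀ p‖ ≤ |p.1| * dist p.2.1 p.2.2 := by
  rw [molecule, norm_smul, RCLike.norm_ofReal]
  exact mul_le_mul_of_nonneg_left (norm_freeDirac_sub_le _ _) (abs_nonneg _)

theorem evalOp_molecule (f : Lip₀ 𝕜 x₀) (p : ℝ × X × X) :
    evalOp f (molecule 𝕜 x₀ p) = p.1 • (f p.2.1 - f p.2.2) := by
  rw [RCLike.real_smul_eq_coe_mul]
  rfl

/-- All but finitely many molecules are within `ε / 2` of `0`, so these exceptions together with `0`
form a finite `ε`-net. -/
theorem totallyBounded_image_molecule {S : Set (ℝ × X × X)}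
    (hS : ∀ ε > 0, {p ∈ S | ε < |p.1| * dist p.2.1 p.2.2}.Finite) :
    TotallyBounded (molecule 𝕜 x₀ '' S) := by
  refine Metric.totallyBounded_iff.2 fun ε hε =>
    ⟨insert 0 (molecule 𝕜 x₀ '' {p ∈ S | ε / 2 < |p.1| * dist p.2.1 p.2.2}),
      ((hS _ (half_pos hε)).image _).insert 0, ?_⟩
  rintro _ ⟨p, hp, rfl⟩
  rw [mem_iUnion₂]
  by_cases h : ε / 2 < |p.1| * dist p.2.1 p.2.2
  · exact ⟨_, mem_insert_of_mem _ ⟨p, ⟨hp, h⟩, rfl⟩, Metric.mem_ball_self hε⟩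
  · refine ⟨0, mem_insert _ _, mem_ball_zero_iff.2 ((norm_molecule_le p).trans_lt ?_)⟩
    linarith

/-- Boundedly open sets that contain `0` contain the polar of a totally bounded subset of the free
space. -/
theorem BoundedlyOpen.exists_totallyBounded {U : Set (Lip₀ 𝕜 x₀)} (hU : BoundedlyOpen U)
    (h0 : 0 ∈ U) : ∃ K : Set (freeSpace 𝕜 x₀), TotallyBounded K ∧
      ∀ f : Lip₀ 𝕜 x₀, (∀ φ ∈ K, ‖evalOp f φ‖ ≤ 1) → f ∈ U := by
  obtain ⟨S, hS, hSU⟩ := hU.exists_molPolar_subset h0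
  refine ⟨molecule 𝕜 x₀ '' S, totallyBounded_image_molecule hS, fun f hf => hSU fun p hp => ?_⟩
  rw [← evalOp_molecule]
  exact hf _ (mem_image_of_mem _ hp)

theorem isOpen_tauGamma_iff_boundedlyOpen {U : Set (Lip₀ 𝕜 x₀)} :
    IsOpen[tauGamma 𝕜 x₀] U ↔ BoundedlyOpen U := by
  constructor
  · intro hU f hf r
    obtain ⟨V, hV, hVU⟩ := (nhds_tauGamma_hasBasis f).mem_iff.1
      ((@isOpen_iff_mem_nhds _ (tauGamma 𝕜 x₀) U).1 hU f hf)
    obtain ⟨k, hk⟩ := exists_two_pow_le r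
    obtain ⟨⟨K, ε⟩, ⟨hK, hε⟩, hKV⟩ := (nhds_tauZero_hasBasis (0 : Lip₀ 𝕜 x₀)).mem_iff.1 (hV k).2.2
    obtain ⟨F, δ, hδ, h⟩ := exists_finset_forall_norm_le (𝕜 := 𝕜) (x₀ := x₀) hK r hε
    refine ⟨F, δ, hδ, fun g hg hgF => hVU ⟨g, ?_, rfl⟩⟩
    -- A single summand, in position `k` where the ball has radius `2^k ≥ r`, already puts `g` in
    -- `γ(V)`.
    refine mem_gammaSet.2 ⟨k + 1, fun i => if i = k then g else 0, fun i _ => ?_, by omega, by simp⟩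
    dsimp only
    split_ifs with hik
    · subst hik
      exact ⟨hKV (by simpa using h g hg hgF), hg.trans hk⟩
    · exact ⟨hV.zero_mem i, by simp⟩
  · intro hU
    refine (@isOpen_iff_mem_nhds _ (tauGamma 𝕜 x₀) U).2 fun f hf => ?_
    -- Translating by `f` reduces to a neighbourhood of `0`.
    obtain ⟨K, hK, hKU⟩ := (hU.preimage_add f).exists_totallyBounded (by simpa using hf)
    obtain ⟨V, hV, hVK⟩ := (nhds_tauGamma_hasBasis (0 : Lip₀ 𝕜 x₀)).mem_iff.1
      (mem_nhds_tauGamma_of_totallyBounded hK one_pos)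
    refine (nhds_tauGamma_hasBasis f).mem_iff.2 ⟨V, hV, ?_⟩
    rintro _ ⟨g, hg, rfl⟩
    exact hKU g (hVK ⟨g, hg, zero_add g⟩)

theorem isOpen_tauGamma_iff {U : Set (Lip₀ 𝕜 x₀)} :
    IsOpen[tauGamma 𝕜 x₀] U ↔ ∀ B : Set (Lip₀ 𝕜 x₀), Bornology.IsBounded B →
      IsOpen[TopologicalSpace.induced ((↑) : B → Lip₀ 𝕜 x₀) (tauZero 𝕜 x₀)]
        ((↑) ⁻¹' U : Set B) :=
  isOpen_tauGamma_iff_boundedlyOpen.trans boundedlyOpen_iff_forall_isOpen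

theorem isClosed_tauGamma_iff {U : Set (Lip₀ 𝕜 x₀)} :
    IsClosed[tauGamma 𝕜 x₀] U ↔ ∀ B : Set (Lip₀ 𝕜 x₀), Bornology.IsBounded B →
      IsClosed[TopologicalSpace.induced ((↑) : B → Lip₀ 𝕜 x₀) (tauZero 𝕜 x₀)]
        ((↑) ⁻¹' U : Set B) := by
  rw [← @isOpen_compl_iff _ _ (tauGamma 𝕜 x₀), isOpen_tauGamma_iff]
  refine forall₂_congr fun B _ => ?_
  rw [preimage_compl]
  exact @isOpen_compl_iff _ _ (TopologicalSpace.induced _ (tauZero 𝕜 x₀))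

theorem tauGamma_le_of_agreeOnBounded {t : TopologicalSpace (Lip₀ 𝕜 x₀)}
    (ht : AgreeOnBounded t (tauZero 𝕜 x₀)) : tauGamma 𝕜 x₀ ≤ t := by
  intro U hU
  refine isOpen_tauGamma_iff.2 fun B hB => ?_
  rw [← ht B hB]
  exact ⟨U, hU, rfl⟩

theorem agreeOnBounded_tauGamma : AgreeOnBounded (tauGamma 𝕜 x₀) (tauZero 𝕜 x₀) := by
  intro B hB
  -- Taking `t = τ₀` in the maximality statement shows that `τ_γ` is finer than `τ₀`.
  refine le_antisymm (induced_mono (tauGamma_le_of_agreeOnBounded fun _ _ => rfl)) ?_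
  rintro _ ⟨U, hU, rfl⟩
  exact isOpen_tauGamma_iff.1 hU B hB

end Gamma

/-! ### Duality between `F(X)` and `(Lip₀(X), τ_γ)` -/

section FreeSpaceDuality

variable {𝕜 : Type*} [RCLike 𝕜] {X : Type*} [MetricSpace X] {x₀ : X}

attribute [local instance] freeSpaceSeminormedAddCommGroup freeSpaceNormedSpace

/-- A functional that is continuous at `0` on the unit ball for the topology of pointwise
convergence belongs to the free space. -/
theorem mem_freeSpace_of_forall_exists_finset {φ : StrongDual 𝕜 (Lip₀ 𝕜 x₀)}
    (hφ : ∀ ε > 0, ∃ F : Finset X, ∃ δ > 0, ∀ f : Lip₀ 𝕜 x₀, ‖f‖ ≤ 1 →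
      (∀ x ∈ F, ‖f x‖ ≤ δ) → ‖φ f‖ ≤ ε) : φ ∈ freeSpace 𝕜 x₀ := by
  refine Metric.mem_closure_iff.2 fun ε hε => ?_
  obtain ⟨F, δ, hδ, h⟩ := hφ (ε / 2) (half_pos hε)
  let L : F → StrongDual 𝕜 (Lip₀ 𝕜 x₀) := fun x => dirac 𝕜 x₀ x
  let N : Submodule 𝕜 (Lip₀ 𝕜 x₀) := ⨅ x, LinearMap.ker (L x : Lip₀ 𝕜 x₀ →ₗ[𝕜] 𝕜)
  have hN : ∀ f ∈ N, ∀ x ∈ F, f x = 0 := fun f hf x hx =>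
    LinearMap.mem_ker.1 ((Submodule.mem_iInf _).1 hf ⟨x, hx⟩)
  -- Hahn–Banach: `g` extends the restriction of `φ` to the common kernel `N` of the chosen
  -- evaluations, with norm at most `ε / 2`. Then `φ - g` vanishes on `N`, so it is a combination of
  -- these evaluations and approximates `φ`.
  obtain ⟨g, hg, hgn⟩ := exists_extension_norm_eq N (φ.comp N.subtypeL)
  have hnorm : ‖φ.comp N.subtypeL‖ ≤ ε / 2 := by
    refine ContinuousLinearMap.opNorm_le_bound _ (half_pos hε).le fun f => ?_
    rcases eq_or_ne (f : Lip₀ 𝕜 x₀) 0 with h0 | h0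
    · have : f = 0 := Subtype.ext h0
      subst this
      simp
    have hpos : 0 < ‖(f : Lip₀ 𝕜 x₀)‖ := norm_pos_iff.2 h0
    have h1 := h (((‖(f : Lip₀ 𝕜 x₀)‖ : 𝕜)⁻¹) • (f : Lip₀ 𝕜 x₀))
      (norm_smul_inv_norm h0).le fun x hx => by
        rw [Lip₀.smul_apply, hN f f.2 x hx, mul_zero, norm_zero]
        exact hδ.le
    rw [map_smul, norm_smul, norm_inv, RCLike.norm_ofReal, abs_of_pos hpos,
      inv_mul_le_iff₀ hpos, mul_comm] at h1
    exact h1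
  have hker : N ≤ LinearMap.ker ((φ - g : StrongDual 𝕜 (Lip₀ 𝕜 x₀)) : Lip₀ 𝕜 x₀ →ₗ[𝕜] 𝕜) := by
    intro f hf
    have := hg ⟨f, hf⟩
    exact LinearMap.mem_ker.2 (sub_eq_zero.2 this.symm)
  have hspan := mem_span_of_iInf_ker_le_ker hker
  have hmem : φ - g ∈ Submodule.span 𝕜 (range L) := by
    rw [show (range fun x => (L x : Lip₀ 𝕜 x₀ →ₗ[𝕜] 𝕜)) =
      ContinuousLinearMap.coeLM 𝕜 '' range L from range_comp _ L, ← Submodule.map_span] at hspan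
    obtain ⟨ψ, hψ, hψ'⟩ := hspan
    rwa [← ContinuousLinearMap.coe_injective hψ']
  refine ⟨φ - g, Submodule.span_mono (range_comp_subset_range _ (dirac 𝕜 x₀)) hmem, ?_⟩
  rw [dist_eq_norm, sub_sub_cancel, hgn]
  linarith

/-- The closed balls of `Lip₀(X)` are `τ_γ`-compact. -/
theorem isCompact_lipGamma_closedBall (r : ℝ) :
    IsCompact {f : LipGamma 𝕜 x₀ | ‖(toGamma 𝕜 x₀).symm f‖ ≤ r} := by
  have h := (isCompact_closedBall_pointwise (𝕜 := 𝕜) (x₀ := x₀) r).image_of_continuousOn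
    (f := fun f : lipSubmodule 𝕜 x₀ => toGamma 𝕜 x₀ f) ?_
  · convert h using 1
    exact (image_id _).symm
  · intro f hf
    refine tendsto_nhds.2 fun U hU hfU => ?_
    filter_upwards [self_mem_nhdsWithin, mem_nhdsWithin_of_mem_nhds
      ((isOpen_tauGamma_iff_boundedlyOpen.1 hU).eventually_mem hfU r)] with g hg hg'
    exact hg' hg

theorem continuous_toGamma : Continuous (toGamma 𝕜 x₀) :=
  ⟨fun _ hU => (isOpen_tauGamma_iff_boundedlyOpen.1 hU).isOpen⟩

/-- An element of the free space as a `τ_γ`-continuous functional. -/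
def freeToDual : freeSpace 𝕜 x₀ →ₗ[𝕜] LipGamma 𝕜 x₀ →L[𝕜] 𝕜 where
  toFun φ :=
    { toLinearMap := ((φ : StrongDual 𝕜 (Lip₀ 𝕜 x₀)) : Lip₀ 𝕜 x₀ →ₗ[𝕜] 𝕜) ∘ₗ
        (toGamma 𝕜 x₀).symm.toLinearMap
      cont := by
        refine continuous_of_continuousAt_zero (((φ : StrongDual 𝕜 (Lip₀ 𝕜 x₀)) :
          Lip₀ 𝕜 x₀ →ₗ[𝕜] 𝕜) ∘ₗ (toGamma 𝕜 x₀).symm.toLinearMap)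
          (Metric.nhds_basis_closedBall.tendsto_right_iff.2 fun ε hε => ?_)
        have := mem_nhds_tauGamma_of_totallyBounded (totallyBounded_singleton φ) hε
        filter_upwards [this] with f hf
        rw [map_zero, mem_closedBall_zero_iff]
        exact hf φ rfl }
  map_add' _ _ := rfl
  map_smul' _ _ := rfl

theorem freeToDual_apply (φ : freeSpace 𝕜 x₀) (f : Lip₀ 𝕜 x₀) :
    freeToDual φ (toGamma 𝕜 x₀ f) = (φ : StrongDual 𝕜 (Lip₀ 𝕜 x₀)) f := rfl

/-- For surjectivity, the preimage of a small ball under a `τ_γ`-continuous functional is boundedly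
open, which is the criterion for membership in `F(X)`. -/
theorem bijective_freeToDual :
    Function.Bijective (freeToDual : freeSpace 𝕜 x₀ →ₗ[𝕜] LipGamma 𝕜 x₀ →L[𝕜] 𝕜) := by
  constructor
  · intro φ ψ h
    refine Subtype.ext (ContinuousLinearMap.ext fun f => ?_)
    rw [← freeToDual_apply, h, freeToDual_apply]
  · intro l
    let φ : StrongDual 𝕜 (Lip₀ 𝕜 x₀) :=
      ⟨(l : LipGamma 𝕜 x₀ →ₗ[𝕜] 𝕜) ∘ₗ (toGamma 𝕜 x₀).toLinearMap,
        l.continuous.comp continuous_toGamma⟩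
    have hφ : φ ∈ freeSpace 𝕜 x₀ := mem_freeSpace_of_forall_exists_finset fun ε hε => by
      have hU : IsOpen (l ⁻¹' Metric.ball 0 ε) := Metric.isOpen_ball.preimage l.continuous
      obtain ⟨F, δ, hδ, h⟩ := isOpen_tauGamma_iff_boundedlyOpen.1 hU 0
        (mem_ball_zero_iff.2 <|
          (congrArg norm (map_zero l)).trans_lt (norm_zero.trans_lt hε)) 1
      refine ⟨F, δ, hδ, fun f hf hfF => ?_⟩
      have := h f hf hfF
      rw [zero_add] at this
      exact (mem_ball_zero_iff.1 this).le
    exact ⟨⟨φ, hφ⟩, rfl⟩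

theorem norm_le_of_norm_evalOp_le {f : Lip₀ 𝕜 x₀} {C : ℝ} (hC : 0 ≤ C)
    (h : ∀ φ : freeSpace 𝕜 x₀, ‖evalOp f φ‖ ≤ C * ‖φ‖) : ‖f‖ ≤ C :=
  Lip₀.norm_le_of hC fun x y =>
    (h (freeDirac 𝕜 x₀ x - freeDirac 𝕜 x₀ y)).trans
      (mul_le_mul_of_nonneg_left (norm_freeDirac_sub_le x y) hC)

instance : CompleteSpace (freeSpace 𝕜 x₀) :=
  (Submodule.isClosed_topologicalClosure _).completeSpace_coe

/-- The `τ_γ`-bounded sets are norm bounded. -/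
theorem exists_norm_le_of_isVonNBounded {S : Set (LipGamma 𝕜 x₀)}
    (hS : Bornology.IsVonNBounded 𝕜 S) : ∃ C, ∀ f ∈ S, ‖(toGamma 𝕜 x₀).symm f‖ ≤ C := by
  -- The operators `T_f`, `f ∈ S`, on the complete space `F(X)` are pointwise bounded because each
  -- `φ` is `τ_γ`-continuous.
  obtain ⟨C, hC⟩ := banach_steinhaus
    (g := fun f : S => evalOp ((toGamma 𝕜 x₀).symm (f : LipGamma 𝕜 x₀))) fun φ => by
      obtain ⟨C, hC⟩ := ((NormedSpace.isVonNBounded_iff 𝕜).1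
        (hS.image (freeToDual φ))).exists_norm_le
      exact ⟨C, fun f => hC _ (mem_image_of_mem _ f.2)⟩
  refine ⟨C, fun f hf => norm_le_of_norm_evalOp_le ((norm_nonneg _).trans (hC ⟨f, hf⟩)) ?_⟩
  exact fun φ => ContinuousLinearMap.le_of_opNorm_le _ (hC ⟨f, hf⟩) φ

/-- The free space is the dual of `(Lip₀(X), τ_γ)` with the topology of uniform convergence on
any family of norm bounded sets that contains the unit ball. -/
theorem exists_continuousLinearEquiv_uniformConvergenceCLM (𝔖 : Set (Set (LipGamma 𝕜 x₀)))
    (h𝔖 : ∀ S ∈ 𝔖, ∃ C, ∀ f ∈ S, ‖(toGamma 𝕜 x₀).symm f‖ ≤ C)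
    (hball : {f : LipGamma 𝕜 x₀ | ‖(toGamma 𝕜 x₀).symm f‖ ≤ 1} ∈ 𝔖) :
    ∃ Φ : freeSpace 𝕜 x₀ ≃L[𝕜] UniformConvergenceCLM (RingHom.id 𝕜) 𝕜 𝔖,
      ∀ (φ : freeSpace 𝕜 x₀) (f : Lip₀ 𝕜 x₀),
        Φ φ (toGamma 𝕜 x₀ f) = (φ : StrongDual 𝕜 (Lip₀ 𝕜 x₀)) f := by
  let e : freeSpace 𝕜 x₀ ≃ₗ[𝕜] UniformConvergenceCLM (RingHom.id 𝕜) 𝕜 𝔖 :=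
    LinearEquiv.ofBijective
      { toFun := fun φ => UniformConvergenceCLM.ofFun (RingHom.id 𝕜) 𝕜 𝔖 (freeToDual φ)
        map_add' := fun φ ψ => map_add freeToDual φ ψ
        map_smul' := fun c φ => map_smul freeToDual c φ } bijective_freeToDual
  have he : ∀ (φ : freeSpace 𝕜 x₀) (f : LipGamma 𝕜 x₀),
      e φ f = (φ : StrongDual 𝕜 (Lip₀ 𝕜 x₀)) ((toGamma 𝕜 x₀).symm f) := fun _ _ => rfl
  refine ⟨⟨e, ?_, ?_⟩, fun φ f => rfl⟩
  · refine continuous_of_continuousAt_zero e.toLinearMap ?_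
    rw [ContinuousAt, map_zero, UniformConvergenceCLM.nhds_zero_eq_of_basis _ _ _
      Metric.nhds_basis_closedBall]
    simp only [Filter.tendsto_iInf, Filter.tendsto_principal]
    intro S hS ε hε
    obtain ⟨C, hC⟩ := h𝔖 S hS
    filter_upwards [Metric.ball_mem_nhds (0 : freeSpace 𝕜 x₀)
      (show 0 < ε / (|C| + 1) by positivity)] with φ hφ f hf
    have h1 : ‖(φ : StrongDual 𝕜 (Lip₀ 𝕜 x₀)) ((toGamma 𝕜 x₀).symm f)‖ ≤
        ε / (|C| + 1) * (|C| + 1) :=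
      ContinuousLinearMap.le_of_opNorm_le_of_le _ (mem_ball_zero_iff.1 hφ).le
        ((hC f hf).trans (by linarith [le_abs_self C]))
    rw [div_mul_cancel₀ _ (by positivity)] at h1
    exact mem_closedBall_zero_iff.2 h1
  · refine continuous_of_continuousAt_zero e.symm.toLinearMap ?_
    rw [ContinuousAt, map_zero]
    refine Metric.nhds_basis_closedBall.tendsto_right_iff.2 fun ε hε => ?_
    -- Uniform smallness on the unit ball, a member of `𝔖`, bounds the operator norm.
    filter_upwards [UniformConvergenceCLM.eventually_nhds_zero_mapsTo (RingHom.id 𝕜) hball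
      (Metric.closedBall_mem_nhds (0 : 𝕜) hε)] with l hl
    obtain ⟨φ, rfl⟩ := e.surjective l
    rw [LinearEquiv.coe_coe, e.symm_apply_apply, mem_closedBall_zero_iff]
    refine ContinuousLinearMap.opNorm_le_of_unit_norm hε.le fun f hf => ?_
    exact mem_closedBall_zero_iff.1 (hl (x := toGamma 𝕜 x₀ f) hf.le)

/-- Totally bounded subsets of the free space lie in convex balanced compact sets. -/
theorem exists_convex_balanced_isCompact {S : Set (freeSpace 𝕜 x₀)} (hS : TotallyBounded S) :
    ∃ K : Set (freeSpace 𝕜 x₀), (Convex ℝ K ∧ Balanced 𝕜 K ∧ IsCompact K) ∧ S ⊆ K := by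
  let : NormedSpace ℝ (freeSpace 𝕜 x₀) := Submodule.normedSpace _
  have hK : IsCompact (Metric.closedBall (0 : 𝕜) 1 • closure S) :=
    (isCompact_closedBall _ _).smul_set (hS.closure.isCompact_of_isClosed isClosed_closure)
  have hb : Balanced 𝕜 (Metric.closedBall (0 : 𝕜) 1 • closure S) := by
    refine balanced_iff_smul_mem.2 fun {a} ha => ?_
    rintro _ ⟨c, hc, φ, hφ, rfl⟩
    refine ⟨a * c, ?_, φ, hφ, mul_smul a c φ⟩
    rw [mem_closedBall_zero_iff] at hc ⊢
    rw [norm_mul]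
    exact mul_le_one₀ ha (norm_nonneg _) hc
  have hb' : Balanced 𝕜 (convexHull ℝ (Metric.closedBall (0 : 𝕜) 1 • closure S)) := by
    refine balanced_iff_smul_mem.2 fun {a} ha φ hφ => ?_
    have hconv := (convex_convexHull ℝ (Metric.closedBall (0 : 𝕜) 1 • closure S)).linear_preimage
      ((LinearMap.lsmul 𝕜 (freeSpace 𝕜 x₀) a).restrictScalars ℝ)
    refine convexHull_min (fun ψ hψ => ?_) hconv hφ
    exact subset_convexHull ℝ (Metric.closedBall (0 : 𝕜) 1 • closure S) (hb.smul_mem ha hψ)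
  refine ⟨closure (convexHull ℝ (Metric.closedBall (0 : 𝕜) 1 • closure S)),
    ⟨(convex_convexHull ℝ _).closure, hb'.closure, ?_⟩, ?_⟩
  · exact (totallyBounded_convexHull.2 hK.totallyBounded).closure.isCompact_of_isClosed
      isClosed_closure
  · exact fun φ hφ => subset_closure (subset_convexHull ℝ _
      ⟨1, by simp, φ, subset_closure hφ, one_smul 𝕜 φ⟩)

/-- The preimage of `l` is `x ↦ l(δ_x)`, which is Lipschitz because `‖δ_x - δ_y‖ ≤ d(x, y)`.
Agreement on the `δ_x` passes to their span and, by density, to `F(X)`. -/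
theorem bijective_evalOp :
    Function.Bijective (evalOp : Lip₀ 𝕜 x₀ → freeSpace 𝕜 x₀ →L[𝕜] 𝕜) := by
  constructor
  · intro f g h
    exact Lip₀.ext fun x => DFunLike.congr_fun h (freeDirac 𝕜 x₀ x)
  · intro l
    have hbase : freeDirac 𝕜 x₀ x₀ = 0 :=
      Subtype.ext (ContinuousLinearMap.ext fun f => f.apply_base)
    let f : Lip₀ 𝕜 x₀ := ⟨fun x => l (freeDirac 𝕜 x₀ x), ⟨‖l‖₊, LipschitzWith.of_dist_le_mul
      fun x y => by
        rw [dist_eq_norm, ← map_sub]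
        exact (l.le_opNorm _).trans
          (mul_le_mul_of_nonneg_left (norm_freeDirac_sub_le x y) (norm_nonneg _))⟩,
      (congrArg l hbase).trans (map_zero l)⟩
    refine ⟨f, ?_⟩
    have hspan : ∀ φ ∈ Submodule.span 𝕜 (range (dirac 𝕜 x₀)), ∀ h : φ ∈ freeSpace 𝕜 x₀,
        evalOp f ⟨φ, h⟩ = l ⟨φ, h⟩ := by
      intro φ hφ
      induction hφ using Submodule.span_induction with
      | mem φ h =>
        obtain ⟨x, rfl⟩ := h
        exact fun _ => rfl
      | zero => exact fun h => (map_zero (evalOp f)).trans (map_zero l).symm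
      | add φ ψ hφ hψ ihφ ihψ =>
        intro h
        have h1 := Submodule.le_topologicalClosure _ hφ
        have h2 := Submodule.le_topologicalClosure _ hψ
        exact (map_add (evalOp f) ⟨φ, h1⟩ ⟨ψ, h2⟩).trans
          ((congrArg₂ _ (ihφ h1) (ihψ h2)).trans (map_add l ⟨φ, h1⟩ ⟨ψ, h2⟩).symm)
      | smul c φ hφ ihφ =>
        intro h
        have h1 := Submodule.le_topologicalClosure _ hφ
        exact (map_smul (evalOp f) c ⟨φ, h1⟩).trans
          ((congrArg _ (ihφ h1)).trans (map_smul l c ⟨φ, h1⟩).symm)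
    have hdense : Dense {φ : freeSpace 𝕜 x₀ |
        (φ : StrongDual 𝕜 (Lip₀ 𝕜 x₀)) ∈ Submodule.span 𝕜 (range (dirac 𝕜 x₀))} := by
      rw [Subtype.dense_iff]
      intro φ hφ
      refine closure_mono (fun ψ hψ => ?_) hφ
      exact ⟨⟨ψ, Submodule.le_topologicalClosure _ hψ⟩, hψ, rfl⟩
    exact DFunLike.coe_injective (Continuous.ext_on hdense (evalOp f).continuous l.continuous
      fun φ hφ => hspan φ hφ φ.2)

/-- `(Lip₀(X), τ_γ)` is the dual of the free space with the topology of uniform convergence on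
convex balanced compact sets. -/
theorem exists_continuousLinearEquiv_dualC :
    ∃ T : LipGamma 𝕜 x₀ ≃L[𝕜] DualC 𝕜 (freeSpace 𝕜 x₀),
      ∀ (f : Lip₀ 𝕜 x₀) (φ : freeSpace 𝕜 x₀), T (toGamma 𝕜 x₀ f) φ = evalOp f φ := by
  let T : LipGamma 𝕜 x₀ →ₗ[𝕜] DualC 𝕜 (freeSpace 𝕜 x₀) :=
    { toFun := fun f => UniformConvergenceCLM.ofFun (RingHom.id 𝕜) 𝕜 _
        (evalOp ((toGamma 𝕜 x₀).symm f))
      map_add' := fun f g => ContinuousLinearMap.ext fun φ =>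
        map_add (φ : StrongDual 𝕜 (Lip₀ 𝕜 x₀)) ((toGamma 𝕜 x₀).symm f) ((toGamma 𝕜 x₀).symm g)
      map_smul' := fun c f => ContinuousLinearMap.ext fun φ =>
        map_smul (φ : StrongDual 𝕜 (Lip₀ 𝕜 x₀)) c ((toGamma 𝕜 x₀).symm f) }
  let e : LipGamma 𝕜 x₀ ≃ₗ[𝕜] DualC 𝕜 (freeSpace 𝕜 x₀) := LinearEquiv.ofBijective T bijective_evalOp
  refine ⟨⟨e, ?_, ?_⟩, fun f φ => rfl⟩
  · refine continuous_of_continuousAt_zero e.toLinearMap ?_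
    rw [ContinuousAt, map_zero, UniformConvergenceCLM.nhds_zero_eq_of_basis _ _ _
      Metric.nhds_basis_closedBall]
    simp only [Filter.tendsto_iInf, Filter.tendsto_principal]
    intro K hK ε hε
    have := mem_nhds_tauGamma_of_totallyBounded hK.2.2.totallyBounded hε
    filter_upwards [this] with f hf φ hφ
    exact mem_closedBall_zero_iff.2 (hf φ hφ)
  · refine continuous_of_continuousAt_zero e.symm.toLinearMap ?_
    rw [ContinuousAt, map_zero]
    refine (nhds_basis_opens (0 : LipGamma 𝕜 x₀)).tendsto_right_iff.2 fun U hU => ?_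
    obtain ⟨S, hS, hSU⟩ :=
      (isOpen_tauGamma_iff_boundedlyOpen.1 hU.2).exists_totallyBounded hU.1
    -- Enlarging `S` to a member of the family defining `F(X)'_c` only shrinks its polar, which
    -- stays inside `U`.
    obtain ⟨K, hK, hSK⟩ := exists_convex_balanced_isCompact hS
    filter_upwards [UniformConvergenceCLM.eventually_nhds_zero_mapsTo (RingHom.id 𝕜)
      (𝔖 := {S : Set (freeSpace 𝕜 x₀) | Convex ℝ S ∧ Balanced 𝕜 S ∧ IsCompact S}) hK
      (Metric.closedBall_mem_nhds (0 : 𝕜) one_pos)] with l hl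
    obtain ⟨f, rfl⟩ := e.surjective l
    rw [LinearEquiv.coe_coe, e.symm_apply_apply]
    exact hSU f fun φ hφ => mem_closedBall_zero_iff.1 (hl (hSK hφ))

theorem convex_balanced_isCompact_lipGamma_closedBall (r : ℝ) :
    Convex ℝ {f : LipGamma 𝕜 x₀ | ‖(toGamma 𝕜 x₀).symm f‖ ≤ r} ∧
      Balanced 𝕜 {f : LipGamma 𝕜 x₀ | ‖(toGamma 𝕜 x₀).symm f‖ ≤ r} ∧
      IsCompact {f : LipGamma 𝕜 x₀ | ‖(toGamma 𝕜 x₀).symm f‖ ≤ r} := by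
  refine ⟨?_, ?_, isCompact_lipGamma_closedBall r⟩
  · let : NormedSpace ℝ (Lip₀ 𝕜 x₀) := ⟨fun c f => by
      rw [← algebraMap_smul 𝕜 c f, norm_smul]
      simp⟩
    have h := convex_closedBall (0 : Lip₀ 𝕜 x₀) r
    have hball : Metric.closedBall (0 : Lip₀ 𝕜 x₀) r = {f | ‖f‖ ≤ r} :=
      Set.ext fun f => mem_closedBall_zero_iff
    rw [hball] at h
    exact h
  · refine balanced_iff_smul_mem.2 fun {a} ha f hf => ?_
    rw [mem_ofPred_eq] at hf ⊢
    rw [map_smul, norm_smul]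
    exact (mul_le_of_le_one_left (norm_nonneg _) ha).trans hf

end FreeSpaceDuality

end LipFree

end

theorem mainTheorem3 {𝕜 : Type*} [RCLike 𝕜] {X : Type*} [MetricSpace X] (x₀ : X) :
    (LipFree.AgreeOnBounded (LipFree.tauGamma 𝕜 x₀) (LipFree.tauZero 𝕜 x₀) ∧
      -- in Mathlib's order on topologies, `s ≤ t` says that `s` is finer than `t`
      ∀ t : TopologicalSpace (LipFree.Lip₀ 𝕜 x₀),
        LipFree.AgreeOnBounded t (LipFree.tauZero 𝕜 x₀) → LipFree.tauGamma 𝕜 x₀ ≤ t) ∧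
    (∀ U : Set (LipFree.Lip₀ 𝕜 x₀),
      (IsOpen[LipFree.tauGamma 𝕜 x₀] U ↔
        ∀ B : Set (LipFree.Lip₀ 𝕜 x₀), Bornology.IsBounded B →
          IsOpen[TopologicalSpace.induced ((↑) : B → LipFree.Lip₀ 𝕜 x₀) (LipFree.tauZero 𝕜 x₀)]
            ((↑) ⁻¹' U : Set B)) ∧
      (IsClosed[LipFree.tauGamma 𝕜 x₀] U ↔
        ∀ B : Set (LipFree.Lip₀ 𝕜 x₀), Bornology.IsBounded B →
          IsClosed[TopologicalSpace.induced ((↑) : B → LipFree.Lip₀ 𝕜 x₀) (LipFree.tauZero 𝕜 x₀)]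
            ((↑) ⁻¹' U : Set B))) ∧
    ((∃ Φ : LipFree.freeSpace 𝕜 x₀ ≃L[𝕜] LipFree.DualB 𝕜 (LipFree.LipGamma 𝕜 x₀),
        ∀ (φ : LipFree.freeSpace 𝕜 x₀) (f : LipFree.Lip₀ 𝕜 x₀),
          Φ φ (LipFree.toGamma 𝕜 x₀ f) = (φ : StrongDual 𝕜 (LipFree.Lip₀ 𝕜 x₀)) f) ∧
      (∃ Ψ : LipFree.freeSpace 𝕜 x₀ ≃L[𝕜] LipFree.DualC 𝕜 (LipFree.LipGamma 𝕜 x₀),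
        ∀ (φ : LipFree.freeSpace 𝕜 x₀) (f : LipFree.Lip₀ 𝕜 x₀),
          Ψ φ (LipFree.toGamma 𝕜 x₀ f) = (φ : StrongDual 𝕜 (LipFree.Lip₀ 𝕜 x₀)) f)) ∧
    (∃ T : LipFree.LipGamma 𝕜 x₀ ≃L[𝕜] LipFree.DualC 𝕜 (LipFree.freeSpace 𝕜 x₀),
      ∀ (f : LipFree.Lip₀ 𝕜 x₀) (φ : LipFree.freeSpace 𝕜 x₀),
        T (LipFree.toGamma 𝕜 x₀ f) φ = LipFree.evalOp f φ) := by
  have hball := LipFree.convex_balanced_isCompact_lipGamma_closedBall (𝕜 := 𝕜) (x₀ := x₀) 1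
  exact ⟨⟨LipFree.agreeOnBounded_tauGamma, fun _ => LipFree.tauGamma_le_of_agreeOnBounded⟩,
    fun _ => ⟨LipFree.isOpen_tauGamma_iff, LipFree.isClosed_tauGamma_iff⟩,
    ⟨LipFree.exists_continuousLinearEquiv_uniformConvergenceCLM _
      (fun _ => LipFree.exists_norm_le_of_isVonNBounded) (hball.2.2.isVonNBounded 𝕜),
    LipFree.exists_continuousLinearEquiv_uniformConvergenceCLM _
      (fun _ hS => LipFree.exists_norm_le_of_isVonNBounded (hS.2.2.isVonNBounded 𝕜)) hball⟩,
    LipFree.exists_continuousLinearEquiv_dualC⟩
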